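/- **Setting.** Let $X,Y$ be (real or complex) Banach spaces and let $A,B$ be closed densely defined linear operators from $X$ to $Y$ with domains $D_A=D\subseteq D_B$, $D\neq\{0\}$, and closed range of $A$. $D$ carries the norm of $X$. Let $f\in C(\mathbb R_+\times D,Y)$, $\mathbb R_+=[0,\infty)$, and consider $$\tfrac{d}{dt}[Ax]+Bx=f(t,x),\qquad x(t_0)=x_0. \tag{1}$$ A *solution* on an interval $J\subseteq\mathbb R_+$ is an $x\in C(J,X)$ with values in $D$, $Ax\in C^1(J,Y)$ (one-sided derivative at an end point belonging to $J$), satisfying the equation on $J$; *maximal* intervals refer to extension to the right. *Index.* $\lambda A+B$ is a regular pencil of index $\nu\ge1$ if all $\lambda\in\mathbb C$ of large modulus are regular points ($(\lambda A+B)^{-1}$ exists and is bounded from $Y$ to $X$) and $\nu$ is the least positive integer with $\|(\lambda A+B)^{-1}\|\le C|\lambda|^{\nu-1}$ for large $|\lambda|$; it has index $0$ if $A^{-1}$ is bounded and everywhere defined on $Y$. For real spaces, pass to complexifications for $\nu\ge 1$. *Decompositions.* Assume that $\lambda A+B$ is a regular pencil of index $\nu$ and $n=\dim\ker A<\infty$.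 Let $\{\varphi_i^j\}$, $1\le i\le n$, $1\le j\le m_i$, be a canonical system of root vectors of $A+\mu B$ at $\mu=0$: $\{\varphi_i^1\}$ is a basis of $\ker A$, $A\varphi_i^j=-B\varphi_i^{j-1}$ for $j\ge2$; and let $q_i^j\in Y^*$ satisfy, on $D$, $q_i^{m_i}A=0$, $q_i^jA=-q_i^{j+1}B$ for $j<m_i$, and $q_k^l(B\varphi_i^j)=\delta_{ik}\delta_{jl}$. Put, for $x\in D$ and $y\in Y$, $$P_{20}x=\sum_i q_i^1(Bx)\varphi_i^1,\quad P_{2\Sigma}x=\sum_i\sum_{j\ge2}q_i^j(Bx)\varphi_i^j,\quad P_1=I-P_{2\Sigma}-P_{20},$$ $$Q_{2*}y=\sum_i q_i^{m_i}(y)B\varphi_i^{m_i},\quad Q_{2\Sigma}y=\sum_i\sum_{j<m_i}q_i^j(y)B\varphi_i^j,\quad Q_1=I-Q_{2\Sigma}-Q_{2*},$$ $D_1=P_1D$, $D_{2\Sigma}=P_{2\Sigma}D$, $D_{20}=\ker A$, $Y_1=Q_1Y$, $Y_{2\Sigma}=Q_{2\Sigma}Y$, $Y_{2*}=Q_{2*}Y$,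 $W=Y_1\dotplus Y_{2\Sigma}$, and $x_1=P_1x$, $x_{2\Sigma}=P_{2\Sigma}x$, $x_{20}=P_{20}x$. Let $\widetilde A=A+\sum_i q_i^1(B\,\cdot)B\varphi_i^{m_i}\colon D\to Y$ (a bijection), $\Pi(t,x)=\widetilde A^{-1}(Q_1+Q_{2\Sigma})[f(t,x)-Bx]$, $F_{2*}(t,x_1,x_{2\Sigma},x_{20})=Q_{2*}f(t,x_1+x_{2\Sigma}+x_{20})-Q_{2*}B(x_{20}+x_{2\Sigma})$ and $L_0=\{(t,x)\in\mathbb R_+\times D: Q_{2*}[f(t,x)-Bx]=0\}$. **Theorem (Lagrange instability).** Assume, in this setting: 1. For all $t\ge0$ and $x_1+x_{2\Sigma}\in D_1\dotplus D_{2\Sigma}$ there is a unique $x_{20}\in D_{20}$ with $(t,x_1+x_{2\Sigma}+x_{20})\in L_0$. 2. For each $(t',x')\in L_0$ there is an operator $W_{t',x'}\colon D_{20}\to Y_{2*}$, bounded with bounded inverse, such that one of the following holds: (a) $f$ is locally Lipschitz in $x$ on $\mathbb R_+\times D$, and for each $(t',x')\in L_0$ and all small $\delta,\varepsilon>0$,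 for $t\geq 0$, $|t-t'|<\delta$, $x_1\in D_1$, $\|x_1-x_1'\|<\delta$, $x_{2\Sigma}\in D_{2\Sigma}$, $\|x_{2\Sigma}-x_{2\Sigma}'\|<\delta$, and $y,z\in D_{20}$ in the $\varepsilon$-ball about $x_{20}'$, $$\|F_{2*}(t,x_1,x_{2\Sigma},y)-F_{2*}(t,x_1,x_{2\Sigma},z)-W_{t',x'}[y-z]\|\le q(\delta,\varepsilon)\|y-z\|,$$ where $q$ may depend on $(t',x')$ and $\lim_{\delta,\varepsilon\to0}q(\delta,\varepsilon)<\|W_{t',x'}^{-1}\|^{-1}$ (the right side is $\infty$ if $D_{20}=\{0\}$); or (b) $f$ has a continuous (Fréchet) partial derivative in $x$ on $\mathbb R_+\times D$, and $W_{t',x'}=[\partial_x(Q_{2*}f)(t',x')-Q_{2*}B]\big|_{D_{20}}$ for each $(t',x')\in L_0$. 3. For all $a_1,a_2>0$ there is $K>0$ such that $\|x_{20}-W_{t,x}^{-1}F_{2*}(t,x_1,x_{2\Sigma},x_{20})\|\le K$ for all $(t,x)\in L_0$ with $t\le a_1$, $\|x_1+x_{2\Sigma}\|\le a_2$, and $\|(Q_1+Q_{2\Sigma})f(t,x)\|$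 is bounded over those of these $(t,x)$ with $\|x_{20}\|\le K$. 4. There is an open set $\widetilde\Omega\subseteq W$ such that, with $\Omega=\widetilde A^{-1}\widetilde\Omega$, for each solution $x(t)$ with $(t_0,x_0)\in L_0$ and $(P_1+P_{2\Sigma})x_0\in\Omega$, $(P_1+P_{2\Sigma})x(t)\in\Omega$ for all $t$ in the maximal interval of existence of $x(t)$. 5. There are $m\ge1$ and continuous $V_i\colon W\to\mathbb R_+$, $i=1,\dots,m$, that are positive and continuously (real) differentiable on $\widetilde\Omega$, a continuous $U\colon(0,\infty)\to(0,\infty)$ and a $\psi\colon\mathbb R_+\to\mathbb R_+$ integrable on each finite interval with $\int_{u_0}^\infty\frac{du}{U(u)}<\infty$ and $\int_{u_0}^\infty\psi(t)\,dt=\infty$ for all $u_0>0$, such that, with $V=\min_iV_i$ and an index $j(w)$ with $V(w)=V_{j(w)}(w)$ for each $w\in W$, $$\big\langle\widetilde A\,\Pi(t,\widetilde A^{-1}w+x_{20}),\partial_wV_{j(w)}(w)\big\rangle\ge U(V(w))\,\psi(t)$$ for all $w\in\widetilde\Omega$, $x_{20}\in D_{20}$ with $(t,\widetilde A^{-1}w+x_{20})\in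 L_0$. Then for each $(t_0,x_0)\in L_0$ with $(P_1+P_{2\Sigma})x_0\in\Omega$ there is a $t_{max}<\infty$ such that (1) has a unique solution $x(t)$ on the maximal interval of existence $[t_0,t_{max})$, and $\lim_{t\to t_{max}-0}\|Ax(t)\|=\infty$. If, in addition, $D=X$ or $A$ is bounded, then $\lim_{t\to t_{max}-0}\|x(t)\|=\infty$. -/

import Mathlib

open Set Filter Topology MeasureTheory

noncomputable section

namespace DegenerateEq

/-! ### Operator pencils and their index -/

section Pencil

variable {𝕜 E F X Y : Type*} [RCLike 𝕜]
  [NormedAddCommGroup E] [NormedSpace 𝕜 E] [NormedAddCommGroup F] [NormedSpace 𝕜 F]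
  [NormedAddCommGroup X] [NormedSpace 𝕜 X] [NormedAddCommGroup Y] [NormedSpace 𝕜 Y]

/-- `R` is the everywhere defined bounded inverse of the partially defined operator `T`. -/
def IsBoundedInverse (T : E →ₗ.[𝕜] F) (R : F →L[𝕜] E) : Prop :=
  (∀ x : T.domain, R (T x) = x) ∧ ∀ y : F, ∃ h : R y ∈ T.domain, T ⟨R y, h⟩ = y

/-- All `z` outside a disc are regular points of the pencil `P`, and the resolvent is
`O(|z| ^ (k - 1))` there. -/
def ResolventGrowth (P : ℂ → E →ₗ.[𝕜] F) (k : ℕ) : Prop :=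
  ∃ C : ℝ, ∃ r > 0, ∀ z : ℂ, r ≤ ‖z‖ →
    ∃ R : F →L[𝕜] E, IsBoundedInverse (P z) R ∧ ‖R‖ ≤ C * ‖z‖ ^ (k - 1)

/-- The pencil `z A + B` with domain `D_A ∩ D_B`, for a complex field of scalars
(`z` is read in `𝕜`). -/
def pencil (A B : X →ₗ.[𝕜] Y) (z : ℂ) : X →ₗ.[𝕜] Y :=
  ((z.re : 𝕜) + (z.im : 𝕜) * RCLike.I) • A + B

/-- The complexified pencil `z Ã + B̃`, for real scalars.  The complexification `X + iX` is written
as `X × X`, so that `(u, v)` stands for `u + i v`; for `z = a + i b` the pencil maps `u + i v`,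
with `u, v ∈ D_A ∩ D_B`, to `(a A u + B u - b A v) + i (b A u + a A v + B v)`. -/
def complexifiedPencil (A B : X →ₗ.[𝕜] Y) (z : ℂ) : (X × X) →ₗ.[𝕜] (Y × Y) :=
  let A' : ↥(A.domain ⊓ B.domain) →ₗ[𝕜] Y := A.toFun ∘ₗ Submodule.inclusion inf_le_left
  let B' : ↥(A.domain ⊓ B.domain) →ₗ[𝕜] Y := B.toFun ∘ₗ Submodule.inclusion inf_le_right
  let D := (A.domain ⊓ B.domain).prod (A.domain ⊓ B.domain)
  let u : D →ₗ[𝕜] ↥(A.domain ⊓ B.domain) :=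
    (LinearMap.fst 𝕜 X X ∘ₗ D.subtype).codRestrict _ fun p => p.2.1
  let v : D →ₗ[𝕜] ↥(A.domain ⊓ B.domain) :=
    (LinearMap.snd 𝕜 X X ∘ₗ D.subtype).codRestrict _ fun p => p.2.2
  { domain := D
    toFun :=
      ((z.re : 𝕜) • (A' ∘ₗ u) + B' ∘ₗ u - (z.im : 𝕜) • (A' ∘ₗ v)).prod
        ((z.im : 𝕜) • (A' ∘ₗ u) + (z.re : 𝕜) • (A' ∘ₗ v) + B' ∘ₗ v) }

/-- `λ A + B` is a regular pencil of index `ν`.  For `ν ≥ 1`: all `λ` with `|λ|` large are regular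
points and `ν` is the least positive integer with `‖(λ A + B)⁻¹‖ = O(|λ| ^ (ν - 1))` at infinity
(for real scalars, `A` and `B` are replaced by their complexifications).  For `ν = 0`: `A` has a
bounded inverse defined on `Y`, and `D_A ⊆ D_B`. -/
def IsRegularPencilOfIndex (A B : X →ₗ.[𝕜] Y) (ν : ℕ) : Prop :=
  (ν = 0 ∧ A.domain ≤ B.domain ∧ ∃ R : Y →L[𝕜] X, IsBoundedInverse A R) ∨
  ((RCLike.I : 𝕜) ≠ 0 ∧ IsLeast {k | 1 ≤ k ∧ ResolventGrowth (pencil A B) k} ν) ∨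
  ((RCLike.I : 𝕜) = 0 ∧ IsLeast {k | 1 ≤ k ∧ ResolventGrowth (complexifiedPencil A B) k} ν)

/-- The restriction of `B` to `D = D_A`. -/
def onDomain (A B : X →ₗ.[𝕜] Y) (hAB : A.domain ≤ B.domain) : A.domain →ₗ[𝕜] Y :=
  B.toFun ∘ₗ Submodule.inclusion hAB

/-- A canonical system `φ_i^j` (`1 ≤ i ≤ n`, `1 ≤ j ≤ m_i`) of eigenvectors and adjoined vectors of
the pencil `A + μ B` at the eigenvalue `μ = 0`, where `n = dim ker A`, together with the
biorthogonal system of functionals `q_i^j ∈ Y*`.  The equations for `A* q_i^j` are equations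
between functionals on `D = D_A`.  The index `i` runs through `Fin n`, the index `j` through
`1, …, m i`; values at other `j` play no role.  Biorthogonality and the equations for `q` make the
chains non-extendable, so that they form a basis of the root subspace at `μ = 0`. -/
structure CanonicalSystem (A B : X →ₗ.[𝕜] Y) (hAB : A.domain ≤ B.domain) (n : ℕ) where
  m : Fin n → ℕ
  φ : Fin n → ℕ → A.domain
  q : Fin n → ℕ → (Y →L[𝕜] 𝕜)
  one_le_m : ∀ i, 1 ≤ m i
  linearIndependent : LinearIndependent 𝕜 fun i => φ i 1
  span_eq_ker : Submodule.span 𝕜 (range fun i => φ i 1) = LinearMap.ker A.toFun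
  chain : ∀ i j, 2 ≤ j → j ≤ m i → A (φ i j) = -onDomain A B hAB (φ i (j - 1))
  q_last : ∀ i, ∀ x : A.domain, q i (m i) (A x) = 0
  q_chain : ∀ i j, 1 ≤ j → j < m i → ∀ x : A.domain,
    q i j (A x) = -q i (j + 1) (onDomain A B hAB x)
  biorthogonal : ∀ i j k l, 1 ≤ j → j ≤ m i → 1 ≤ l → l ≤ m k →
    q k l (onDomain A B hAB (φ i j)) = if i = k ∧ j = l then 1 else 0

end Pencil

namespace CanonicalSystem

variable {𝕜 X Y : Type*} [RCLike 𝕜]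
  [NormedAddCommGroup X] [NormedSpace 𝕜 X] [NormedAddCommGroup Y] [NormedSpace 𝕜 Y]
  {A B : X →ₗ.[𝕜] Y} {hAB : A.domain ≤ B.domain} {n : ℕ}

/-! ### Projectors and subspaces -/

/-- `P_20 = ∑_i ⟨·, B* q_i^1⟩ φ_i^1`, on `D`. -/
def P20 (S : CanonicalSystem A B hAB n) : A.domain →ₗ[𝕜] A.domain :=
  ∑ i, ((S.q i 1 : Y →ₗ[𝕜] 𝕜) ∘ₗ onDomain A B hAB).smulRight (S.φ i 1)

/-- `P_2Σ = ∑_i ∑_{2 ≤ j ≤ m_i} ⟨·, B* q_i^j⟩ φ_i^j`, on `D`. -/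
def P2Sigma (S : CanonicalSystem A B hAB n) : A.domain →ₗ[𝕜] A.domain :=
  ∑ i, ∑ j ∈ Finset.Icc 2 (S.m i),
    ((S.q i j : Y →ₗ[𝕜] 𝕜) ∘ₗ onDomain A B hAB).smulRight (S.φ i j)

/-- `P_1 = I - P_2`, `P_2 = P_2Σ + P_20`, on `D`. -/
def P1 (S : CanonicalSystem A B hAB n) : A.domain →ₗ[𝕜] A.domain :=
  LinearMap.id - (S.P2Sigma + S.P20)

/-- `Q_2* = ∑_i ⟨·, q_i^{m_i}⟩ B φ_i^{m_i}`. -/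
def Q2star (S : CanonicalSystem A B hAB n) : Y →L[𝕜] Y :=
  ∑ i, (S.q i (S.m i)).smulRight (onDomain A B hAB (S.φ i (S.m i)))

/-- `Q_2Σ = ∑_i ∑_{1 ≤ j ≤ m_i - 1} ⟨·, q_i^j⟩ B φ_i^j`. -/
def Q2Sigma (S : CanonicalSystem A B hAB n) : Y →L[𝕜] Y :=
  ∑ i, ∑ j ∈ Finset.Ico 1 (S.m i), (S.q i j).smulRight (onDomain A B hAB (S.φ i j))

/-- `Q_1 = I - Q_2`, `Q_2 = Q_2Σ + Q_2*`. -/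
def Q1 (S : CanonicalSystem A B hAB n) : Y →L[𝕜] Y :=
  ContinuousLinearMap.id 𝕜 Y - (S.Q2Sigma + S.Q2star)

/-- `D_1 = P_1 D`. -/
def D1 (S : CanonicalSystem A B hAB n) : Submodule 𝕜 A.domain := LinearMap.range S.P1

/-- `D_2Σ = P_2Σ D`. -/
def D2Sigma (S : CanonicalSystem A B hAB n) : Submodule 𝕜 A.domain := LinearMap.range S.P2Sigma

/-- `D_20 = ker A`. -/
def D20 (_S : CanonicalSystem A B hAB n) : Submodule 𝕜 A.domain := LinearMap.ker A.toFun

/-- `Y_2* = span {B φ_i^{m_i}}`. -/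
def Y2star (S : CanonicalSystem A B hAB n) : Submodule 𝕜 Y :=
  Submodule.span 𝕜 (range fun i => onDomain A B hAB (S.φ i (S.m i)))

/-- `W = Y_1 ∔ Y_2Σ`, where `Y_1 = Q_1 Y` and `Y_2Σ = Q_2Σ Y`. -/
def W (S : CanonicalSystem A B hAB n) : Submodule 𝕜 Y :=
  LinearMap.range (S.Q1 : Y →ₗ[𝕜] Y) ⊔ LinearMap.range (S.Q2Sigma : Y →ₗ[𝕜] Y)

theorem Q2star_mem (S : CanonicalSystem A B hAB n) (y : Y) : S.Q2star y ∈ S.Y2star := by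
  simp only [Q2star, Y2star, sum_apply, ContinuousLinearMap.smulRight_apply]
  exact Submodule.sum_mem _ fun i _ =>
    Submodule.smul_mem _ _ (Submodule.subset_span (mem_range_self i))

theorem Q1_add_Q2Sigma_mem (S : CanonicalSystem A B hAB n) (y : Y) :
    (S.Q1 + S.Q2Sigma) y ∈ S.W :=
  Submodule.add_mem_sup (LinearMap.mem_range_self (S.Q1 : Y →ₗ[𝕜] Y) y)
    (LinearMap.mem_range_self (S.Q2Sigma : Y →ₗ[𝕜] Y) y)

/-- `Q_2*` as a map into `Y_2*`. -/
def projY2star (S : CanonicalSystem A B hAB n) : Y →L[𝕜] S.Y2star :=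
  S.Q2star.codRestrict S.Y2star S.Q2star_mem

/-- `Q_1 + Q_2Σ` as a map into `W`; this is the identity on `W`. -/
def projW (S : CanonicalSystem A B hAB n) : Y →L[𝕜] S.W :=
  (S.Q1 + S.Q2Sigma).codRestrict S.W S.Q1_add_Q2Sigma_mem

/-- `Ã = A + ∑_i ⟨·, B* q_i^1⟩ B φ_i^{m_i} : D → Y`. -/
def tildeA (S : CanonicalSystem A B hAB n) : A.domain →ₗ[𝕜] Y :=
  A.toFun + ∑ i, ((S.q i 1 : Y →ₗ[𝕜] 𝕜) ∘ₗ onDomain A B hAB).smulRight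
    (onDomain A B hAB (S.φ i (S.m i)))

/-- `Ã⁻¹ : Y → D`; for a regular pencil with an index, `Ã` is a bijection of `D` onto `Y`. -/
def tildeAInv (S : CanonicalSystem A B hAB n) : Y → A.domain :=
  Function.invFun S.tildeA

/-! ### The equation `d/dt [A x] + B x = f (t, x)` -/

/-- The consistency manifold `L_0 = {(t, x) ∈ ℝ₊ × D | Q_2* [f(t, x) - B x] = 0}`. -/
def L0 (S : CanonicalSystem A B hAB n) (f : ℝ → A.domain → Y) : Set (ℝ × A.domain) :=
  {p | 0 ≤ p.1 ∧ S.Q2star (f p.1 p.2 - onDomain A B hAB p.2) = 0}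

/-- `Π(t, x) = Ã⁻¹ (Q_1 + Q_2Σ) [f(t, x) - B x]`. -/
def Pi (S : CanonicalSystem A B hAB n) (f : ℝ → A.domain → Y) (t : ℝ) (x : A.domain) : A.domain :=
  S.tildeAInv ((S.Q1 + S.Q2Sigma) (f t x - onDomain A B hAB x))

/-- `F_2*(t, x_1, x_2Σ, x_20) = Q_2* f(t, x_1 + x_2Σ + x_20) - Q_2* B (x_20 + x_2Σ)`. -/
def F2star (S : CanonicalSystem A B hAB n) (f : ℝ → A.domain → Y) (t : ℝ)
    (x₁ xs x₀ : A.domain) : S.Y2star :=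
  S.projY2star (f t (x₁ + xs + x₀)) - S.projY2star (onDomain A B hAB (x₀ + xs))

/-- `f` is locally Lipschitz with respect to `x` on `ℝ₊ × D`. -/
def LocallyLipschitzInX (f : ℝ → A.domain → Y) : Prop :=
  ∀ t' : ℝ, 0 ≤ t' → ∀ x' : A.domain, ∃ δ > 0, ∃ L : ℝ, 0 ≤ L ∧
    ∀ t : ℝ, 0 ≤ t → |t - t'| < δ → ∀ x y : A.domain, ‖x - x'‖ < δ → ‖y - x'‖ < δ →
      ‖f t x - f t y‖ ≤ L * ‖x - y‖

/-- For all `t ≥ 0` and `x_1 + x_2Σ ∈ D_1 ∔ D_2Σ` there is a unique `x_20 ∈ D_20` with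
`(t, x_1 + x_2Σ + x_20) ∈ L_0`. -/
def UniqueAlgebraicPart (S : CanonicalSystem A B hAB n) (f : ℝ → A.domain → Y) : Prop :=
  ∀ t : ℝ, 0 ≤ t → ∀ s ∈ S.D1 ⊔ S.D2Sigma, ∃! x₀ : A.domain, x₀ ∈ S.D20 ∧ (t, s + x₀) ∈ S.L0 f

/-- The local Lipschitz form of the second condition, for a family of operators
`Wop t x : D_20 → Y_2*`, invertible at the points of `L_0`.  In the inequality
`lim q(δ, ε) < ‖W⁻¹‖⁻¹`, written as `ℓ * ‖W⁻¹‖ < 1`, the right side is `∞` if `D_20 = 0`. -/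
def LipschitzCondition (S : CanonicalSystem A B hAB n) (f : ℝ → A.domain → Y)
    (Wop : ℝ → A.domain → (S.D20 →L[𝕜] S.Y2star)) : Prop :=
  LocallyLipschitzInX f ∧
  ∀ t' x', (t', x') ∈ S.L0 f → (Wop t' x').IsInvertible ∧
    ∃ (q : ℝ → ℝ → ℝ) (ℓ : ℝ),
      Tendsto (fun p : ℝ × ℝ => q p.1 p.2) (𝓝[>] 0 ×ˢ 𝓝[>] 0) (𝓝 ℓ) ∧
      ℓ * ‖(Wop t' x').inverse‖ < 1 ∧
      ∃ r > 0, ∀ δ ε : ℝ, 0 < δ → δ < r → 0 < ε → ε < r →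
        ∀ t : ℝ, 0 ≤ t → |t - t'| < δ →
        ∀ x₁ ∈ S.D1, ‖x₁ - S.P1 x'‖ < δ →
        ∀ xs ∈ S.D2Sigma, ‖xs - S.P2Sigma x'‖ < δ →
        ∀ y z : S.D20, ‖(y : A.domain) - S.P20 x'‖ < ε → ‖(z : A.domain) - S.P20 x'‖ < ε →
          ‖S.F2star f t x₁ xs y - S.F2star f t x₁ xs z - Wop t' x' (y - z)‖ ≤ q δ ε * ‖y - z‖

/-- The differentiable form of the second condition: `f` has a continuous partial derivative in `x`
on `ℝ₊ × D`, and `Wop t x = [∂_x (Q_2* f)(t, x) - Q_2* B] P_20` on `D_20` is invertible at the points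
of `L_0`. -/
def DifferentiableCondition (S : CanonicalSystem A B hAB n) (f : ℝ → A.domain → Y)
    (Wop : ℝ → A.domain → (S.D20 →L[𝕜] S.Y2star)) : Prop :=
  ∃ f' : ℝ → A.domain → (A.domain →L[𝕜] Y),
    (∀ t : ℝ, 0 ≤ t → ∀ x, HasFDerivAt (f t) (f' t x) x) ∧
    ContinuousOn (fun p : ℝ × A.domain => f' p.1 p.2) (Ici 0 ×ˢ univ) ∧
    ∀ t x, (t, x) ∈ S.L0 f → (Wop t x).IsInvertible ∧
      ∀ v : S.D20, Wop t x v =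
        S.projY2star (f' t x (v : A.domain)) - S.projY2star (onDomain A B hAB v)

/-- The boundedness condition: for all `a₁, a₂ > 0` there is `K > 0` such that, over `(t, x) ∈ L_0`
with `t ≤ a₁` and `‖x_1 + x_2Σ‖ ≤ a₂`, the norm of `x_20 - W⁻¹ F_2*` is at most `K`, and
`(Q_1 + Q_2Σ) f(t, x)` is bounded over those of these points with `‖x_20‖ ≤ K`. -/
def BoundednessCondition (S : CanonicalSystem A B hAB n) (f : ℝ → A.domain → Y)
    (Wop : ℝ → A.domain → (S.D20 →L[𝕜] S.Y2star)) : Prop :=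
  ∀ a₁ a₂ : ℝ, 0 < a₁ → 0 < a₂ → ∃ K > 0,
    (∀ t x, (t, x) ∈ S.L0 f → t ≤ a₁ → ‖S.P1 x + S.P2Sigma x‖ ≤ a₂ →
      ‖S.P20 x - (((Wop t x).inverse (S.F2star f t (S.P1 x) (S.P2Sigma x) (S.P20 x)) : S.D20) :
        A.domain)‖ ≤ K) ∧
    ∃ M : ℝ, ∀ t x, (t, x) ∈ S.L0 f → t ≤ a₁ → ‖S.P1 x + S.P2Sigma x‖ ≤ a₂ → ‖S.P20 x‖ ≤ K →
      ‖(S.Q1 + S.Q2Sigma) (f t x)‖ ≤ M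

end CanonicalSystem

/-! ### Solutions -/

section Solutions

variable {𝕜 X Y : Type*} [RCLike 𝕜]
  [NormedAddCommGroup X] [NormedSpace 𝕜 X]
  [NormedAddCommGroup Y] [NormedSpace 𝕜 Y] [NormedSpace ℝ Y]

/-- `x` solves `d/dt [A x] + B x = f (t, x)` on the interval `J`: `x ∈ C(J, X)` has values in `D`,
`A x ∈ C¹(J, Y)` (with the one-sided derivative at an end point that belongs to `J`), and the
equation holds at every `t ∈ J`. -/
def IsSolutionOn (A B : X →ₗ.[𝕜] Y) (hAB : A.domain ≤ B.domain) (f : ℝ → A.domain → Y)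
    (J : Set ℝ) (x : ℝ → A.domain) : Prop :=
  ContinuousOn (fun t => (x t : X)) J ∧
  ∃ v : ℝ → Y, ContinuousOn v J ∧ ∀ t ∈ J,
    HasDerivWithinAt (fun s => A (x s)) (v t) J t ∧ v t + onDomain A B hAB (x t) = f t (x t)

/-- `J` is a nondegenerate interval with left end point `t₀ ∈ J`. -/
def IsForwardInterval (t₀ : ℝ) (J : Set ℝ) : Prop :=
  J.OrdConnected ∧ IsLeast J t₀ ∧ J.Nontrivial

/-- `J` is the (right) maximal interval of existence of the solution `x` that starts at `t₀`. -/
def IsMaximalSolution (A B : X →ₗ.[𝕜] Y) (hAB : A.domain ≤ B.domain) (f : ℝ → A.domain → Y)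
    (t₀ : ℝ) (J : Set ℝ) (x : ℝ → A.domain) : Prop :=
  IsForwardInterval t₀ J ∧ IsSolutionOn A B hAB f J x ∧
  ∀ (J' : Set ℝ) (y : ℝ → A.domain), IsForwardInterval t₀ J' → J ⊂ J' →
    IsSolutionOn A B hAB f J' y → ¬ EqOn x y J

end Solutions

end DegenerateEq

end

/-!
The equation reduces to an ordinary differential equation on the Banach space `W = ker Q_2*`, and
the functionals `V_i` make its solutions blow up.

*The operator `Ã`.*  Injectivity of `Ã` follows from biorthogonality; surjectivity amounts to
`range A = W` (`exists_A_eq`).  The functionals `q_i^j` reduce the pencil, so for `y` annihilated by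
all of them the solutions of `A x + s B x = y`, which exist for arbitrarily small real `s ≠ 0`, lie
in a complement of `ker A`.  There `‖B x‖ ≤ C ‖A x‖`, because `A` has closed range, hence
`A x → y` as `s → 0`.  (For a pencil of index `0` the operator `A` itself is onto.)  With the graph
norm of `A` on `D` the open mapping theorem makes both `Ã⁻¹ : Y → D` and `B Ã⁻¹ : Y → Y` bounded
(`exists_continuousLinearMap_inverse`).

*The reduced equation.*  On `D` one has `x = Ã⁻¹ (A x) + x_20`.  By the first two conditions the
algebraic equation `Q_2* [f(t, x) - B x] = 0` has the unique solution `x_20 = η (t, w)`, `w = A x`,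
and `η` is continuous and locally Lipschitz in `w`, as the fixed point of the local contractions
`z ↦ z - W_{t',x'}⁻¹ F_2*(t, x_1, x_2Σ, z)`; the differentiable version of the second condition also
yields these contractions, by the mean value inequality.  Solutions `x` then correspond to integral
curves `w = A x` of the field `(Q_1 + Q_2Σ) [f(t, x) - B x]`, `x = Ã⁻¹ w + η (t, w)`
(`isIntegralCurveOn_of_isSolutionOn`, `isSolutionOn_of_isIntegralCurveOn`).

*Alternative for maximal solutions.*  On `L_0` the map `F_2*` vanishes, so the third condition
bounds `x_20`, and the field is bounded on bounded sets.  For such a field a maximal solution is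
global or satisfies `‖w(t)‖ → ∞` at a finite time
(`IsLocallyLipschitzField.exists_global_or_blowUp`).

*No global solutions.*  Along a global solution `w(t)` stays in the open set `Ω'`, and
`v = min V_i(w(t))` is locally Lipschitz with `v' ≥ U(v) ψ` almost everywhere, since at a point of
differentiability of `v` its derivative is that of each `V_i(w(t))` attaining the minimum.  So
`∫_1^v du / U(u)`, which is bounded, dominates `∫ ψ`, which is not (`false_of_forall_growth`).
-/

noncomputable section

namespace DegenerateEq

/-! ### The graph of `A` as a Banach space -/

section Graph

variable {𝕜 X Y : Type*} [RCLike 𝕜]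
  [NormedAddCommGroup X] [NormedSpace 𝕜 X] [NormedAddCommGroup Y] [NormedSpace 𝕜 Y]

/-- The projection of the graph of `A` onto the domain of `A`.  The graph carries the norm of
`X × Y`, so this is a linear bijection onto `D_A` that turns the graph norm into the norm of the
source. -/
def graphToDomain (A : X →ₗ.[𝕜] Y) : A.graph →ₗ[𝕜] A.domain :=
  (LinearMap.fst 𝕜 X Y ∘ₗ A.graph.subtype).codRestrict A.domain fun g =>
    A.mem_domain_of_mem_graph (y := g.1.2) g.2

theorem apply_graphToDomain (A : X →ₗ.[𝕜] Y) (g : A.graph) : A (graphToDomain A g) = g.1.2 :=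
  A.mem_graph_snd_inj (A.mem_graph _) g.2 rfl

theorem graphToDomain_bijective (A : X →ₗ.[𝕜] Y) : Function.Bijective (graphToDomain A) := by
  refine ⟨fun g h hgh => ?_, fun x => ⟨⟨(x, A x), A.mem_graph x⟩, rfl⟩⟩
  refine Subtype.ext (Prod.ext (congrArg Subtype.val hgh) ?_)
  rw [← apply_graphToDomain, ← apply_graphToDomain, hgh]

theorem continuous_graphToDomain (A : X →ₗ.[𝕜] Y) : Continuous (graphToDomain A) :=
  (continuous_fst.comp continuous_subtype_val).subtype_mk _

theorem continuous_apply_graphToDomain (A : X →ₗ.[𝕜] Y) :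
    Continuous fun g => A (graphToDomain A g) := by
  simp only [apply_graphToDomain]
  exact continuous_snd.comp continuous_subtype_val

/-- A closed operator whose domain contains `D_A` is bounded with respect to the graph norm
of `A`, by the closed graph theorem. -/
theorem continuous_onDomain_graphToDomain [CompleteSpace X] [CompleteSpace Y]
    {A B : X →ₗ.[𝕜] Y} (hAB : A.domain ≤ B.domain) (hA : A.IsClosed) (hB : B.IsClosed) :
    Continuous (onDomain A B hAB ∘ₗ graphToDomain A) := by
  have : CompleteSpace A.graph := IsClosed.completeSpace_coe (hs := hA)
  refine LinearMap.continuous_of_seq_closed_graph _ fun u g y hu hy => ?_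
  have h1 : Tendsto (fun k => ((u k).1.1, (onDomain A B hAB ∘ₗ graphToDomain A) (u k))) atTop
      (𝓝 (g.1.1, y)) :=
    (((continuous_fst.comp continuous_subtype_val).tendsto g).comp hu).prodMk_nhds hy
  have h2 : (g.1.1, y) ∈ B.graph :=
    IsClosed.mem_of_tendsto hB h1 <| Eventually.of_forall fun k =>
      B.mem_graph (Submodule.inclusion hAB (graphToDomain A (u k)))
  exact B.mem_graph_snd_inj h2 (B.mem_graph (Submodule.inclusion hAB (graphToDomain A g))) rfl

end Graph

/-! ### Regular points of the pencil -/

section Regular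

variable {𝕜 X Y : Type*} [RCLike 𝕜]
  [NormedAddCommGroup X] [NormedSpace 𝕜 X] [NormedAddCommGroup Y] [NormedSpace 𝕜 Y]

/-- Solvability at large real parameters.  There the complexified pencil acts on the real and
imaginary parts separately, so real and complex scalars are treated alike; the first alternative is
index `0`. -/
theorem IsRegularPencilOfIndex.surjective_or {A B : X →ₗ.[𝕜] Y} (hAB : A.domain ≤ B.domain)
    {ν : ℕ} (h : IsRegularPencilOfIndex A B ν) :
    (∀ y, ∃ x, A x = y) ∨
      ∃ r > 0, ∀ z : ℝ, r ≤ z → ∀ y, ∃ x, (z : 𝕜) • A x + onDomain A B hAB x = y := by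
  rcases h with ⟨-, -, R, -, hR⟩ | ⟨-, ⟨-, C, r, hr, h⟩, -⟩ | ⟨-, ⟨-, C, r, hr, h⟩, -⟩
  · exact Or.inl fun y => ⟨_, (hR y).2⟩
  · refine Or.inr ⟨r, hr, fun z hz y => ?_⟩
    obtain ⟨R, ⟨-, hR⟩, -⟩ := h z (by simpa [abs_of_pos (hr.trans_le hz)] using hz)
    obtain ⟨hy, hRy⟩ := hR y
    refine ⟨⟨R y, hy.1⟩, ?_⟩
    simp only [pencil, LinearPMap.add_apply, LinearPMap.smul_apply, Complex.ofReal_re,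
      Complex.ofReal_im, RCLike.ofReal_zero, zero_mul, add_zero] at hRy
    exact hRy
  · refine Or.inr ⟨r, hr, fun z hz y => ?_⟩
    obtain ⟨R, ⟨-, hR⟩, -⟩ := h z (by simpa [abs_of_pos (hr.trans_le hz)] using hz)
    obtain ⟨hy, hRy⟩ := hR (y, 0)
    refine ⟨⟨(R (y, 0)).1, hy.1.1⟩, ?_⟩
    have := congrArg Prod.fst hRy
    simp only [complexifiedPencil, LinearPMap.mk_apply, Complex.ofReal_re,
      Complex.ofReal_im, RCLike.ofReal_zero, zero_smul, sub_zero] at this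
    exact this

end Regular

namespace CanonicalSystem

variable {𝕜 X Y : Type*} [RCLike 𝕜]
  [NormedAddCommGroup X] [NormedSpace 𝕜 X] [NormedAddCommGroup Y] [NormedSpace 𝕜 Y]
  {A B : X →ₗ.[𝕜] Y} {hAB : A.domain ≤ B.domain} {n : ℕ} (S : CanonicalSystem A B hAB n)

/-! ### Algebra of the projectors -/

theorem P20_apply (x : A.domain) :
    S.P20 x = ∑ i, S.q i 1 (onDomain A B hAB x) • S.φ i 1 := by
  simp [P20]

theorem P2Sigma_apply (x : A.domain) :
    S.P2Sigma x = ∑ i, ∑ j ∈ Finset.Icc 2 (S.m i), S.q i j (onDomain A B hAB x) • S.φ i j := by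
  simp [P2Sigma]

theorem Q2star_apply (y : Y) :
    S.Q2star y = ∑ i, S.q i (S.m i) y • onDomain A B hAB (S.φ i (S.m i)) := by
  simp [Q2star]

theorem Q2Sigma_apply (y : Y) :
    S.Q2Sigma y = ∑ i, ∑ j ∈ Finset.Ico 1 (S.m i), S.q i j y • onDomain A B hAB (S.φ i j) := by
  simp [Q2Sigma]

theorem tildeA_apply (x : A.domain) :
    S.tildeA x =
      A x + ∑ i, S.q i 1 (onDomain A B hAB x) • onDomain A B hAB (S.φ i (S.m i)) := by
  simp [tildeA]

theorem P1_add_P2Sigma (x : A.domain) : S.P1 x + S.P2Sigma x = x - S.P20 x := by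
  simp only [P1, LinearMap.sub_apply, LinearMap.add_apply, LinearMap.id_apply]
  abel

theorem Q1_add_Q2Sigma (y : Y) : (S.Q1 + S.Q2Sigma) y = y - S.Q2star y := by
  simp only [Q1, sub_apply, add_apply,
    ContinuousLinearMap.id_apply]
  abel

theorem q_last_Q2star (k : Fin n) (y : Y) : S.q k (S.m k) (S.Q2star y) = S.q k (S.m k) y := by
  rw [Q2star_apply, map_sum, Finset.sum_eq_single k]
  · rw [map_smul, S.biorthogonal _ _ _ _ (S.one_le_m k) le_rfl (S.one_le_m k) le_rfl]
    simp
  · intro i _ hi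
    rw [map_smul, S.biorthogonal _ _ _ _ (S.one_le_m i) le_rfl (S.one_le_m k) le_rfl,
      if_neg fun h => hi h.1, smul_zero]
  · simp

theorem Q2star_eq_zero_iff (y : Y) : S.Q2star y = 0 ↔ ∀ k, S.q k (S.m k) y = 0 := by
  refine ⟨fun h k => ?_, fun h => ?_⟩
  · rw [← q_last_Q2star, h, map_zero]
  · simp [Q2star_apply, h]

theorem q_Q2Sigma (k : Fin n) {l : ℕ} (hl : 1 ≤ l) (hlm : l ≤ S.m k) (y : Y) :
    S.q k l (S.Q2Sigma y) = if l < S.m k then S.q k l y else 0 := by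
  rw [Q2Sigma_apply, map_sum, Finset.sum_eq_single k]
  · have h : ∀ j ∈ Finset.Ico 1 (S.m k),
        S.q k l (S.q k j y • onDomain A B hAB (S.φ k j)) = if j = l then S.q k l y else 0 := by
      intro j hj
      obtain ⟨h1, h2⟩ := Finset.mem_Ico.1 hj
      rw [map_smul, S.biorthogonal _ _ _ _ h1 h2.le hl hlm]
      by_cases hjl : j = l <;> simp [hjl]
    rw [map_sum, Finset.sum_congr rfl h, Finset.sum_ite_eq']
    simp [hl]
  · intro i _ hi
    rw [map_sum]
    refine Finset.sum_eq_zero fun j hj => ?_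
    obtain ⟨h1, h2⟩ := Finset.mem_Ico.1 hj
    rw [map_smul, S.biorthogonal _ _ _ _ h1 h2.le hl hlm, if_neg fun h => hi h.1, smul_zero]
  · simp

theorem Q2star_Q2Sigma (y : Y) : S.Q2star (S.Q2Sigma y) = 0 := by
  rw [Q2star_eq_zero_iff]
  intro k
  rw [q_Q2Sigma _ _ (S.one_le_m k) le_rfl, if_neg (lt_irrefl _)]

theorem Q2star_Q2star (y : Y) : S.Q2star (S.Q2star y) = S.Q2star y := by
  rw [Q2star_apply, Q2star_apply S y]
  exact Finset.sum_congr rfl fun i _ => by rw [← Q2star_apply, q_last_Q2star]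

/-- `W` is the kernel of the projector `Q_2*`. -/
theorem mem_W_iff (y : Y) : y ∈ S.W ↔ S.Q2star y = 0 := by
  constructor
  · intro h
    obtain ⟨_, ⟨a, rfl⟩, _, ⟨b, rfl⟩, rfl⟩ := Submodule.mem_sup.1 h
    simp [Q1, Q2star_Q2Sigma, Q2star_Q2star]
  · intro h
    have := S.Q1_add_Q2Sigma_mem y
    rwa [Q1_add_Q2Sigma, h, sub_zero] at this

theorem coe_projW (y : Y) : (S.projW y : Y) = y - S.Q2star y := S.Q1_add_Q2Sigma y

theorem projW_coe (w : S.W) : S.projW w = w :=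
  Subtype.ext <| by rw [coe_projW, (S.mem_W_iff _).1 w.2, sub_zero]

theorem projY2star_eq_zero_iff (y : Y) : S.projY2star y = 0 ↔ S.Q2star y = 0 :=
  Subtype.ext_iff

theorem isClosed_W : IsClosed (S.W : Set Y) := by
  have : (S.W : Set Y) = S.Q2star ⁻¹' {0} := by
    ext y
    exact S.mem_W_iff y
  rw [this]
  exact isClosed_singleton.preimage S.Q2star.continuous

theorem Q2star_A (x : A.domain) : S.Q2star (A x) = 0 :=
  (S.Q2star_eq_zero_iff _).2 fun k => S.q_last k x

theorem A_mem_W (x : A.domain) : A x ∈ S.W := (S.mem_W_iff _).2 (S.Q2star_A x)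

theorem mem_D20_iff (x : A.domain) : x ∈ S.D20 ↔ A x = 0 := Iff.rfl

theorem φ_one_mem_D20 (i : Fin n) : S.φ i 1 ∈ S.D20 := by
  rw [D20, ← S.span_eq_ker]
  exact Submodule.subset_span (mem_range_self i)

theorem P20_mem_D20 (x : A.domain) : S.P20 x ∈ S.D20 := by
  rw [P20_apply]
  exact Submodule.sum_mem _ fun i _ => Submodule.smul_mem _ _ (S.φ_one_mem_D20 i)

instance : FiniteDimensional 𝕜 S.D20 := by
  have : FiniteDimensional 𝕜 (Submodule.span 𝕜 (range fun i => S.φ i 1)) :=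
    FiniteDimensional.span_of_finite 𝕜 (finite_range _)
  rw [S.span_eq_ker] at this
  exact this

theorem q_B_φ_one (k i : Fin n) {l : ℕ} (hl : 1 ≤ l) (hlm : l ≤ S.m k) :
    S.q k l (onDomain A B hAB (S.φ i 1)) = if i = k ∧ 1 = l then 1 else 0 :=
  S.biorthogonal _ _ _ _ le_rfl (S.one_le_m i) hl hlm

theorem P20_eq_self {x : A.domain} (hx : x ∈ S.D20) : S.P20 x = x := by
  rw [D20, ← S.span_eq_ker] at hx
  induction hx using Submodule.span_induction with
  | mem x h =>
    obtain ⟨i, rfl⟩ := h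
    rw [P20_apply, Finset.sum_eq_single i]
    · simp [S.q_B_φ_one i i le_rfl (S.one_le_m i)]
    · intro k _ hk
      rw [S.q_B_φ_one k i le_rfl (S.one_le_m k), if_neg fun h => hk h.1.symm, zero_smul]
    · simp
  | zero => simp
  | add x y _ _ hx hy => rw [map_add, hx, hy]
  | smul c x _ hx => rw [map_smul, hx]

theorem P2Sigma_eq_zero {x : A.domain} (hx : x ∈ S.D20) : S.P2Sigma x = 0 := by
  rw [D20, ← S.span_eq_ker] at hx
  induction hx using Submodule.span_induction with
  | mem x h =>
    obtain ⟨i, rfl⟩ := h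
    rw [P2Sigma_apply]
    refine Finset.sum_eq_zero fun k _ => Finset.sum_eq_zero fun j hj => ?_
    obtain ⟨h1, h2⟩ := Finset.mem_Icc.1 hj
    rw [S.q_B_φ_one k i (by omega) h2, if_neg fun h => by omega, zero_smul]
  | zero => simp
  | add x y _ _ hx hy => rw [map_add, hx, hy, add_zero]
  | smul c x _ hx => rw [map_smul, hx, smul_zero]

theorem P1_eq_zero {x : A.domain} (hx : x ∈ S.D20) : S.P1 x = 0 := by
  have := S.P1_add_P2Sigma x
  rwa [S.P2Sigma_eq_zero hx, S.P20_eq_self hx, add_zero, sub_self] at this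

/-- `q_k^{m_k} B P_1 = 0`, so `Q_2* B` does not see the component `x_1`. -/
theorem Q2star_B_P1 (x : A.domain) : S.Q2star (onDomain A B hAB (S.P1 x)) = 0 := by
  rw [Q2star_eq_zero_iff]
  intro k
  have hm := S.one_le_m k
  have h20 : S.q k (S.m k) (onDomain A B hAB (S.P20 x)) =
      if 1 = S.m k then S.q k 1 (onDomain A B hAB x) else 0 := by
    rw [P20_apply, map_sum, map_sum, Finset.sum_eq_single k]
    · rw [map_smul, map_smul, S.q_B_φ_one k k hm le_rfl]
      simp
    · intro i _ hi
      rw [map_smul, map_smul, S.q_B_φ_one k i hm le_rfl, if_neg fun h => hi h.1, smul_zero]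
    · simp
  have h2s : S.q k (S.m k) (onDomain A B hAB (S.P2Sigma x)) =
      if 1 = S.m k then 0 else S.q k (S.m k) (onDomain A B hAB x) := by
    rw [P2Sigma_apply, map_sum, map_sum, Finset.sum_eq_single k]
    · have h : ∀ j ∈ Finset.Icc 2 (S.m k), S.q k (S.m k) (onDomain A B hAB
          (S.q k j (onDomain A B hAB x) • S.φ k j)) =
          if j = S.m k then S.q k (S.m k) (onDomain A B hAB x) else 0 := by
        intro j hj
        obtain ⟨h1, h2⟩ := Finset.mem_Icc.1 hj
        rw [map_smul, map_smul, S.biorthogonal _ _ _ _ (by omega) h2 hm le_rfl]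
        by_cases hjm : j = S.m k <;> simp [hjm]
      rw [map_sum, map_sum, Finset.sum_congr rfl h, Finset.sum_ite_eq']
      by_cases h1 : 1 = S.m k
      · simp [← h1]
      · rw [if_pos (Finset.mem_Icc.2 ⟨by omega, le_rfl⟩), if_neg h1]
    · intro i _ hi
      rw [map_sum, map_sum]
      refine Finset.sum_eq_zero fun j hj => ?_
      obtain ⟨h1, h2⟩ := Finset.mem_Icc.1 hj
      rw [map_smul, map_smul, S.biorthogonal _ _ _ _ (by omega) h2 hm le_rfl,
        if_neg fun h => hi h.1, smul_zero]
    · simp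
  have h := S.P1_add_P2Sigma x
  rw [eq_sub_iff_add_eq, ← eq_sub_iff_add_eq, ← eq_sub_iff_add_eq] at h
  rw [h, map_sub, map_sub, map_sub, map_sub, h20, h2s]
  by_cases h1 : 1 = S.m k
  · simp [← h1]
  · simp [h1]

theorem q_last_tildeA (k : Fin n) (x : A.domain) :
    S.q k (S.m k) (S.tildeA x) = S.q k 1 (onDomain A B hAB x) := by
  rw [tildeA_apply, map_add, S.q_last, zero_add, map_sum, Finset.sum_eq_single k]
  · rw [map_smul, S.biorthogonal _ _ _ _ (S.one_le_m k) le_rfl (S.one_le_m k) le_rfl]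
    simp
  · intro i _ hi
    rw [map_smul, S.biorthogonal _ _ _ _ (S.one_le_m i) le_rfl (S.one_le_m k) le_rfl,
      if_neg fun h => hi h.1, smul_zero]
  · simp

theorem P20_eq_zero_iff (x : A.domain) :
    S.P20 x = 0 ↔ ∀ k, S.q k 1 (onDomain A B hAB x) = 0 := by
  refine ⟨fun h k => ?_, fun h => ?_⟩
  · rw [P20_apply] at h
    exact Fintype.linearIndependent_iff.1 S.linearIndependent _ h k
  · simp [P20_apply, h]

theorem tildeA_eq_A {x : A.domain} (hx : S.P20 x = 0) : S.tildeA x = A x := by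
  rw [P20_eq_zero_iff] at hx
  simp [tildeA_apply, hx]

theorem P20_eq_zero_of_tildeA_mem_W {x : A.domain} (hx : S.tildeA x ∈ S.W) : S.P20 x = 0 := by
  rw [mem_W_iff, Q2star_eq_zero_iff] at hx
  rw [P20_eq_zero_iff]
  exact fun k => by rw [← q_last_tildeA, hx k]

theorem tildeA_injective : Function.Injective S.tildeA := by
  rw [← LinearMap.ker_eq_bot, LinearMap.ker_eq_bot']
  intro x hx
  have h0 := S.P20_eq_zero_of_tildeA_mem_W (hx ▸ S.W.zero_mem)
  rw [S.tildeA_eq_A h0] at hx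
  rw [← S.P20_eq_self hx, h0]

/-! ### `Ã` is an isomorphism -/

theorem Q2Sigma_mem_range_A (y : Y) : ∃ x, A x = S.Q2Sigma y := by
  refine ⟨∑ i, ∑ j ∈ Finset.Ico 1 (S.m i), -(S.q i j y • S.φ i (j + 1)), ?_⟩
  change A.toFun _ = _
  rw [Q2Sigma_apply, map_sum]
  refine Finset.sum_congr rfl fun i _ => ?_
  rw [map_sum]
  refine Finset.sum_congr rfl fun j hj => ?_
  obtain ⟨h1, h2⟩ := Finset.mem_Ico.1 hj
  have := S.chain i (j + 1) (by omega) h2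
  rw [map_neg, map_smul]
  change -(S.q i j y • A (S.φ i (j + 1))) = _
  rw [this]
  simp

/-- On the complement `ker P_20` of `ker A` the operator `B` is bounded relative to `A`: the range
of `A` is closed, so `A` has a bounded right inverse into the graph of `A`. -/
theorem exists_norm_B_le [CompleteSpace X] [CompleteSpace Y] (hA : A.IsClosed) (hB : B.IsClosed)
    (hran : IsClosed (range fun x : A.domain => A x)) :
    ∃ C > 0, ∀ x : A.domain, S.P20 x = 0 → ‖onDomain A B hAB x‖ ≤ C * ‖A x‖ := by
  have : CompleteSpace A.graph := IsClosed.completeSpace_coe (hs := hA)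
  have hran' : IsClosed (LinearMap.range A.toFun : Set Y) := hran
  have : CompleteSpace (LinearMap.range A.toFun) := hran'.completeSpace_coe
  let a : A.graph →L[𝕜] LinearMap.range A.toFun :=
    ⟨(A.toFun.rangeRestrict ∘ₗ graphToDomain A),
      (continuous_apply_graphToDomain A).subtype_mk _⟩
  let b : A.graph →L[𝕜] Y :=
    ⟨onDomain A B hAB ∘ₗ graphToDomain A, continuous_onDomain_graphToDomain hAB hA hB⟩
  have ha : Function.Surjective a :=
    A.toFun.surjective_rangeRestrict.comp (graphToDomain_bijective A).2
  obtain ⟨C, hC, h⟩ := a.exists_preimage_norm_le ha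
  -- `T (B x) = B (x - P_20 x)`
  let T : Y →L[𝕜] Y :=
    ContinuousLinearMap.id 𝕜 Y - ∑ i, (S.q i 1).smulRight (onDomain A B hAB (S.φ i 1))
  have hT : ∀ x, T (onDomain A B hAB x) = onDomain A B hAB (x - S.P20 x) := by
    intro x
    rw [map_sub, P20_apply, map_sum]
    simp [T]
  refine ⟨‖T‖ * (‖b‖ * C) + 1, by positivity, fun x hx => ?_⟩
  obtain ⟨g, hg, hgn⟩ := h ⟨A x, x, rfl⟩
  have hgx : A (graphToDomain A g) = A x := congrArg Subtype.val hg
  have hmem : graphToDomain A g - x ∈ S.D20 := by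
    change A.toFun _ = 0
    rw [map_sub, sub_eq_zero]
    exact hgx
  have hxg : x = graphToDomain A g - S.P20 (graphToDomain A g) := by
    have h1 := S.P20_eq_self hmem
    rw [map_sub, hx, sub_zero] at h1
    rw [h1]
    abel
  have hBx : onDomain A B hAB x = T (b g) := by
    conv_lhs => rw [hxg]
    rw [← hT]
    rfl
  have hgn' : ‖g‖ ≤ C * ‖A x‖ := hgn
  calc ‖onDomain A B hAB x‖ ≤ ‖T‖ * ‖b g‖ := by rw [hBx]; exact T.le_opNorm _
    _ ≤ ‖T‖ * (‖b‖ * (C * ‖A x‖)) := by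
      gcongr
      exact (b.le_opNorm g).trans (by gcongr)
    _ ≤ (‖T‖ * (‖b‖ * C) + 1) * ‖A x‖ := by nlinarith [norm_nonneg (A x)]

/-- The functionals `q_k^l` reduce the pencil: if they annihilate `A x + s B x` with `s ≠ 0`, then
they annihilate `B x`. -/
theorem q_B_eq_zero {s : 𝕜} (hs : s ≠ 0) {x : A.domain} (k : Fin n)
    (h : ∀ l, 1 ≤ l → l ≤ S.m k → S.q k l (A x + s • onDomain A B hAB x) = 0)
    {l : ℕ} (hl : 1 ≤ l) (hlm : l ≤ S.m k) : S.q k l (onDomain A B hAB x) = 0 := by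
  induction hlm using Nat.decreasingInduction with
  | self =>
    have := h _ hl le_rfl
    rw [map_add, S.q_last, map_smul, zero_add, smul_eq_mul] at this
    exact (mul_eq_zero.1 this).resolve_left hs
  | of_succ j hj ih =>
    have := h _ hl hj.le
    rw [map_add, S.q_chain k j hl hj, ih (by omega), map_smul, neg_zero, zero_add,
      smul_eq_mul] at this
    exact (mul_eq_zero.1 this).resolve_left hs

/-- The range of `A` is `W`.  For `y` annihilated by all `q_k^l` the solutions of
`A x + s B x = y` satisfy `P_20 x = 0`, hence `‖B x‖ ≤ C ‖A x‖`, so `A x → y` as `s → 0`, and the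
range of `A` is closed; the remaining part `Q_2Σ y` is a combination of the vectors
`A φ_i^j`. -/
theorem exists_A_eq [CompleteSpace X] [CompleteSpace Y] (hA : A.IsClosed) (hB : B.IsClosed)
    (hran : IsClosed (range fun x : A.domain => A x)) {ν : ℕ} (hν : IsRegularPencilOfIndex A B ν)
    {y : Y} (hy : y ∈ S.W) : ∃ x, A x = y := by
  rcases hν.surjective_or hAB with h | ⟨r, hr, h⟩
  · exact h y
  obtain ⟨C, hC, hBA⟩ := S.exists_norm_B_le hA hB hran
  rw [mem_W_iff, Q2star_eq_zero_iff] at hy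
  suffices h1 : y - S.Q2Sigma y ∈ range fun x : A.domain => A x by
    obtain ⟨x₁, hx₁⟩ := h1
    obtain ⟨x₂, hx₂⟩ := S.Q2Sigma_mem_range_A y
    refine ⟨x₁ + x₂, ?_⟩
    change A.toFun _ = _
    rw [map_add]
    change A x₁ + A x₂ = y
    rw [hx₂, show A x₁ = y - S.Q2Sigma y from hx₁, sub_add_cancel]
  set y₁ := y - S.Q2Sigma y with hy₁
  have hq : ∀ k l, 1 ≤ l → l ≤ S.m k → S.q k l y₁ = 0 := by
    intro k l hl hlm
    rw [hy₁, map_sub, q_Q2Sigma _ _ hl hlm]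
    rcases hlm.lt_or_eq with h1 | rfl
    · simp [h1]
    · simp [hy k]
  rw [← hran.closure_eq, Metric.mem_closure_iff]
  intro ε hε
  obtain ⟨z, hz1, hz2, hz3⟩ : ∃ z : ℝ, r ≤ z ∧ 2 * C ≤ z ∧ 2 * C * ‖y₁‖ / ε < z :=
    ((eventually_ge_atTop r).and ((eventually_ge_atTop (2 * C)).and
      (eventually_gt_atTop _))).exists
  have hz : 0 < z := hr.trans_le hz1
  have hz' : (z : 𝕜) ≠ 0 := RCLike.ofReal_ne_zero.2 hz.ne'
  obtain ⟨x, hx⟩ := h z hz1 ((z : 𝕜) • y₁)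
  have hx' : A x + (z : 𝕜)⁻¹ • onDomain A B hAB x = y₁ := by
    rw [← smul_right_injective Y hz' |>.eq_iff, smul_add, smul_smul, mul_inv_cancel₀ hz', one_smul,
      hx]
  have hP : S.P20 x = 0 := by
    rw [P20_eq_zero_iff]
    intro k
    refine S.q_B_eq_zero (inv_ne_zero hz') k ?_ le_rfl (S.one_le_m k)
    rw [hx']
    exact hq k
  have hBx := hBA x hP
  have hdiff : ‖y₁ - A x‖ = z⁻¹ * ‖onDomain A B hAB x‖ := by
    rw [← hx', add_sub_cancel_left, norm_smul, norm_inv, RCLike.norm_ofReal, abs_of_pos hz]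
  have hhalf : z⁻¹ * (C * ‖A x‖) ≤ ‖A x‖ / 2 := by
    rw [inv_mul_le_iff₀ hz]
    nlinarith [norm_nonneg (A x)]
  have hle : ‖y₁ - A x‖ ≤ z⁻¹ * (C * ‖A x‖) := by
    rw [hdiff]
    gcongr
  have hAx : ‖A x‖ ≤ 2 * ‖y₁‖ := by
    have := norm_sub_norm_le (A x) y₁
    rw [norm_sub_rev (A x) y₁] at this
    linarith
  refine ⟨A x, ⟨x, rfl⟩, ?_⟩
  rw [dist_eq_norm]
  calc ‖y₁ - A x‖ ≤ z⁻¹ * (C * (2 * ‖y₁‖)) := hle.trans (by gcongr)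
    _ < ε := by
      rw [inv_mul_lt_iff₀ hz]
      rw [div_lt_iff₀ hε] at hz3
      linarith

theorem tildeA_surjective [CompleteSpace X] [CompleteSpace Y] (hA : A.IsClosed) (hB : B.IsClosed)
    (hran : IsClosed (range fun x : A.domain => A x)) {ν : ℕ}
    (hν : IsRegularPencilOfIndex A B ν) : Function.Surjective S.tildeA := by
  intro y
  -- `Ã` maps `φ_i^1` to `B φ_i^{m_i}`, and it agrees with `A` on the kernel of `P_20`
  obtain ⟨x, hx⟩ := S.exists_A_eq hA hB hran hν (S.projW y).2
  let z := ∑ i, S.q i (S.m i) y • S.φ i 1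
  have hz : S.tildeA z = S.Q2star y := by
    have hzA : A z = 0 := (S.mem_D20_iff z).1 <|
      Submodule.sum_mem _ fun i _ => Submodule.smul_mem _ _ (S.φ_one_mem_D20 i)
    rw [tildeA_apply, hzA, zero_add, Q2star_apply]
    refine Finset.sum_congr rfl fun k _ => ?_
    congr 1
    rw [map_sum, map_sum, Finset.sum_eq_single k]
    · rw [map_smul, map_smul, S.q_B_φ_one k k le_rfl (S.one_le_m k)]
      simp
    · intro i _ hi
      rw [map_smul, map_smul, S.q_B_φ_one k i le_rfl (S.one_le_m k), if_neg fun h => hi h.1,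
        smul_zero]
    · simp
  have hP : S.P20 (x - S.P20 x) = 0 := by
    rw [map_sub, S.P20_eq_self (S.P20_mem_D20 x), sub_self]
  refine ⟨x - S.P20 x + z, ?_⟩
  have hAP : A (x - S.P20 x) = A x := by
    have h1 : A.toFun (S.P20 x) = 0 := S.P20_mem_D20 x
    change A.toFun _ = A.toFun _
    rw [map_sub, h1, sub_zero]
  rw [map_add, hz, S.tildeA_eq_A hP, hAP, hx, coe_projW, sub_add_cancel]

/-- The inverse of `Ã` is bounded from `Y` to `D`, and `B Ã⁻¹` is bounded on `Y`: with the graph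
norm of `A` on `D`, the operator `Ã` is a bounded bijection of Banach spaces. -/
theorem exists_continuousLinearMap_inverse [CompleteSpace X] [CompleteSpace Y] (hA : A.IsClosed)
    (hB : B.IsClosed) (hran : IsClosed (range fun x : A.domain => A x)) {ν : ℕ}
    (hν : IsRegularPencilOfIndex A B ν) :
    ∃ (E : Y →L[𝕜] A.domain) (BE : Y →L[𝕜] Y), (∀ y, S.tildeA (E y) = y) ∧
      (∀ y, S.tildeAInv y = E y) ∧ ∀ y, BE y = onDomain A B hAB (E y) := by
  have : CompleteSpace A.graph := IsClosed.completeSpace_coe (hs := hA)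
  have hb := continuous_onDomain_graphToDomain hAB hA hB
  let b : A.graph →L[𝕜] Y := ⟨onDomain A B hAB ∘ₗ graphToDomain A, hb⟩
  have hT : Continuous (S.tildeA ∘ₗ graphToDomain A) := by
    have : ⇑(S.tildeA ∘ₗ graphToDomain A) = fun g => A (graphToDomain A g) +
        ∑ i, S.q i 1 (b g) • onDomain A B hAB (S.φ i (S.m i)) := by
      ext g
      exact S.tildeA_apply _
    rw [this]
    exact (continuous_apply_graphToDomain A).add <| continuous_finsetSum _ fun i _ =>
      ((S.q i 1).continuous.comp b.continuous).smul continuous_const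
  let T : A.graph →L[𝕜] Y := ⟨S.tildeA ∘ₗ graphToDomain A, hT⟩
  have hbij : Function.Bijective T :=
    Function.Bijective.comp (g := S.tildeA)
      ⟨S.tildeA_injective, S.tildeA_surjective hA hB hran hν⟩ (graphToDomain_bijective A)
  let e := ContinuousLinearEquiv.ofBijective T (LinearMap.ker_eq_bot.2 hbij.1)
    (LinearMap.range_eq_top.2 hbij.2)
  have he : ∀ y, S.tildeA (graphToDomain A (e.symm y)) = y := fun y =>
    ContinuousLinearEquiv.ofBijective_apply_symm_apply T _ _ y
  let p : A.graph →L[𝕜] A.domain := ⟨graphToDomain A, continuous_graphToDomain A⟩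
  refine ⟨p ∘L (e.symm : Y →L[𝕜] A.graph), b ∘L (e.symm : Y →L[𝕜] A.graph), he, fun y => ?_,
    fun y => rfl⟩
  apply S.tildeA_injective
  rw [tildeAInv, Function.invFun_eq ⟨_, he y⟩]
  exact (he y).symm

end CanonicalSystem

end DegenerateEq
namespace DegenerateEq

/-! ### Maximal solutions of ordinary differential equations in a Banach space -/

section ODE

variable {E : Type*} [NormedAddCommGroup E] [NormedSpace ℝ E]

/-- `g (t, x)` is locally Lipschitz in `x`, locally uniformly in `t`. -/
def IsLocallyLipschitzField (g : ℝ → E → E) : Prop :=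
  ∀ t x, ∃ K : NNReal, ∃ δ > 0, ∀ s, |s - t| < δ → LipschitzOnWith K (g s) (Metric.ball x δ)

theorem IsLocallyLipschitzField.eqOn_Icc {g : ℝ → E → E} (hl : IsLocallyLipschitzField g)
    {a b : ℝ} {α β : ℝ → E} (hα : IsIntegralCurveOn α g (Icc a b))
    (hβ : IsIntegralCurveOn β g (Icc a b)) (h : α a = β a) : EqOn α β (Icc a b) := by
  have hαc : ContinuousOn α (Icc a b) := fun t ht => (hα t ht).continuousWithinAt
  have hβc : ContinuousOn β (Icc a b) := fun t ht => (hβ t ht).continuousWithinAt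
  refine IsClosed.Icc_subset_of_forall_mem_nhdsWithin (s := {t | α t = β t}) ?_ h ?_
  · rw [inter_comm]
    exact (hαc.prodMk hβc).preimage_isClosed_of_isClosed isClosed_Icc isClosed_diagonal
  · rintro x ⟨hx, hxab⟩
    obtain ⟨K, δ, hδ, hK⟩ := hl x (α x)
    have hxI : Icc a b ∈ 𝓝[≥] x :=
      mem_of_superset (Icc_mem_nhdsGE hxab.2) (Icc_subset_Icc_left hxab.1)
    have h1 : ∀ᶠ t in 𝓝[≥] x, α t ∈ Metric.ball (α x) δ :=
      (hαc x (Ico_subset_Icc_self hxab)).mono_of_mem_nhdsWithin hxI (Metric.ball_mem_nhds _ hδ)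
    have h2 : ∀ᶠ t in 𝓝[≥] x, β t ∈ Metric.ball (α x) δ := by
      refine (hβc x (Ico_subset_Icc_self hxab)).mono_of_mem_nhdsWithin hxI ?_
      rw [show β x = α x from hx.symm]
      exact Metric.ball_mem_nhds _ hδ
    have h3 : ∀ᶠ t in 𝓝[≥] x, |t - x| < δ :=
      mem_nhdsWithin_of_mem_nhds (Metric.ball_mem_nhds x hδ)
    obtain ⟨c, hxc, hc⟩ := mem_nhdsGE_iff_exists_Icc_subset.1 (h1.and (h2.and (h3.and hxI)))
    refine mem_of_superset (Icc_mem_nhdsGT hxc) ?_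
    have hsub : Icc x c ⊆ Icc a b := fun t ht => (hc ht).2.2.2
    have hge : ∀ t ∈ Ico x c, Icc a b ∈ 𝓝[≥] t := fun t ht =>
      mem_of_superset (Icc_mem_nhdsGE ht.2) ((Icc_subset_Icc_left ht.1).trans hsub)
    exact ODE_solution_unique_of_mem_Icc_right (v := g) (s := fun _ => Metric.ball (α x) δ) (K := K)
      (fun t ht => hK t (hc (Ico_subset_Icc_self ht)).2.2.1) (hαc.mono hsub)
      (fun t ht => (hα t (hsub (Ico_subset_Icc_self ht))).mono_of_mem_nhdsWithin (hge t ht))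
      (fun t ht => (hc (Ico_subset_Icc_self ht)).1) (hβc.mono hsub)
      (fun t ht => (hβ t (hsub (Ico_subset_Icc_self ht))).mono_of_mem_nhdsWithin (hge t ht))
      (fun t ht => (hc (Ico_subset_Icc_self ht)).2.1) hx

theorem IsLocallyLipschitzField.eqOn {g : ℝ → E → E} (hl : IsLocallyLipschitzField g)
    {J : Set ℝ} (hJ : J.OrdConnected) {a : ℝ} (ha : IsLeast J a) {α β : ℝ → E}
    (hα : IsIntegralCurveOn α g J) (hβ : IsIntegralCurveOn β g J) (h : α a = β a) :
    EqOn α β J := fun t ht =>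
  have hsub : Icc a t ⊆ J := hJ.out ha.1 ht
  hl.eqOn_Icc (hα.mono hsub) (hβ.mono hsub) h ⟨ha.2 ht, le_rfl⟩

theorem IsLocallyLipschitzField.exists_local [CompleteSpace E] {g : ℝ → E → E}
    (hl : IsLocallyLipschitzField g) (hc : Continuous fun p : ℝ × E => g p.1 p.2)
    (t₀ : ℝ) (x₀ : E) :
    ∃ ε > 0, ∃ α : ℝ → E, α t₀ = x₀ ∧ IsIntegralCurveOn α g (Icc t₀ (t₀ + ε)) := by
  obtain ⟨K, δ, hδ, hK⟩ := hl t₀ x₀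
  have h1 : ∀ᶠ p : ℝ × E in 𝓝 (t₀, x₀), ‖g p.1 p.2‖ < ‖g t₀ x₀‖ + 1 :=
    hc.norm.continuousAt.eventually (gt_mem_nhds (by simp))
  obtain ⟨ρ, hρ, hM⟩ := Metric.eventually_nhds_iff.1 h1
  obtain ⟨L, hL⟩ : ∃ L : NNReal, (L : ℝ) = ‖g t₀ x₀‖ + 1 := ⟨⟨_, by positivity⟩, rfl⟩
  obtain ⟨a, ha⟩ : ∃ a : NNReal, (a : ℝ) = min δ ρ / 2 := ⟨⟨_, by positivity⟩, rfl⟩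
  have hLpos : (0 : ℝ) < L := by rw [hL]; positivity
  have hapos : (0 : ℝ) < a := by rw [ha]; positivity
  have haδ : (a : ℝ) < δ := by linarith [min_le_left δ ρ]
  have haρ : (a : ℝ) < ρ := by linarith [min_le_right δ ρ]
  let ε : ℝ := min (a : ℝ) (a / L)
  have hε : 0 < ε := by positivity
  have habs : ∀ t ∈ Icc t₀ (t₀ + ε), |t - t₀| ≤ a := fun t ht => by
    rw [abs_of_nonneg (by linarith [ht.1])]
    linarith [ht.2, min_le_left (a : ℝ) (a / L)]
  have hP : IsPicardLindelof g (⟨t₀, by constructor <;> linarith⟩ : Icc t₀ (t₀ + ε))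
      x₀ a 0 L K := by
    refine ⟨fun t ht => (hK t ((habs t ht).trans_lt haδ)).mono
      (Metric.closedBall_subset_ball haδ), fun x _ => ?_, fun t ht x hx => ?_, ?_⟩
    · exact (hc.comp (continuous_id.prodMk continuous_const)).continuousOn
    · rw [hL]
      refine (hM (y := (t, x)) ?_).le
      rw [Prod.dist_eq, max_lt_iff]
      exact ⟨(habs t ht).trans_lt haρ, (Metric.mem_closedBall.1 hx).trans_lt haρ⟩
    · simp only [add_sub_cancel_left, sub_self, NNReal.coe_zero, sub_zero]
      rw [max_eq_left hε.le, ← le_div_iff₀' hLpos]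
      exact min_le_right _ _
  obtain ⟨α, hα0, hα⟩ := hP.exists_eq_forall_mem_Icc_hasDerivWithinAt₀
  exact ⟨ε, hε, α, hα0, hα⟩

theorem exists_isIntegralCurveOn_Icc_glue {g : ℝ → E → E} {a b c : ℝ}
    {α β : ℝ → E} (hab : a ≤ b) (hbc : b ≤ c)
    (hα : IsIntegralCurveOn α g (Icc a b)) (hβ : IsIntegralCurveOn β g (Icc b c))
    (h : α b = β b) :
    ∃ γ : ℝ → E, γ a = α a ∧ IsIntegralCurveOn γ g (Icc a c) := by
  let γ : ℝ → E := fun t => if t ≤ b then α t else β t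
  have h1 : EqOn γ α (Icc a b) := fun t ht => if_pos ht.2
  have h2 : EqOn γ β (Icc b c) := fun t ht => by
    rcases ht.1.eq_or_lt with rfl | h'
    · exact (if_pos le_rfl).trans h
    · exact if_neg (not_le.2 h')
  have h1' : IsIntegralCurveOn γ g (Icc a b) := fun t ht => by
    rw [h1 ht]; exact (hα t ht).congr h1 (h1 ht)
  have h2' : IsIntegralCurveOn γ g (Icc b c) := fun t ht => by
    rw [h2 ht]; exact (hβ t ht).congr h2 (h2 ht)
  refine ⟨γ, h1 ⟨le_rfl, hab⟩, fun t ht => ?_⟩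
  rcases lt_trichotomy t b with htb | rfl | htb
  · exact (h1' t ⟨ht.1, htb.le⟩).mono_of_mem_nhdsWithin <|
      mem_of_superset (inter_mem_nhdsWithin _ (Iic_mem_nhds htb)) fun s hs => ⟨hs.1.1, hs.2⟩
  · rw [← Icc_union_Icc_eq_Icc hab hbc]
    exact (h1' t ⟨hab, le_rfl⟩).union (h2' t ⟨le_rfl, hbc⟩)
  · exact (h2' t ⟨htb.le, ht.2⟩).mono_of_mem_nhdsWithin <|
      mem_of_superset (inter_mem_nhdsWithin _ (Ici_mem_nhds htb)) fun s hs => ⟨hs.2, hs.1.2⟩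

/-- If `g` is bounded on bounded sets, a solution on `[a, b)` whose norm does not tend to infinity
extends to `[a, b]`: from a time close to `b` at which the norm is at most `R` the solution cannot
leave the ball of radius `R + 1` before `b`, so it is Lipschitz up to `b` and has a limit there. -/
theorem exists_isIntegralCurveOn_Icc_of_not_tendsto [CompleteSpace E] {g : ℝ → E → E}
    (hc : Continuous fun p : ℝ × E => g p.1 p.2) {a b : ℝ} (hab : a < b)
    (hbd : ∀ R : ℝ, ∃ M : ℝ, ∀ t ∈ Icc a b, ∀ x : E, ‖x‖ ≤ R → ‖g t x‖ ≤ M)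
    {α : ℝ → E} (hα : IsIntegralCurveOn α g (Ico a b))
    (hnt : ¬ Tendsto (fun t => ‖α t‖) (𝓝[<] b) atTop) :
    ∃ γ : ℝ → E, γ a = α a ∧ IsIntegralCurveOn γ g (Icc a b) := by
  obtain ⟨R, hR⟩ : ∃ R, ∃ᶠ t in 𝓝[<] b, ‖α t‖ ≤ R := by
    rw [tendsto_atTop] at hnt
    push Not at hnt
    obtain ⟨R, hR⟩ := hnt
    exact ⟨R, hR.mono fun t ht => ht.le⟩
  obtain ⟨M, hM⟩ := hbd (R + 1)
  have hM0 : 0 < |M| + 1 := by positivity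
  have hnear : ∀ᶠ t in 𝓝[<] b, t ∈ Ioo (max a (b - 1 / (|M| + 1))) b :=
    Ioo_mem_nhdsLT (max_lt hab (by linarith [one_div_pos.2 hM0]))
  obtain ⟨t₁, ht₁R, ht₁⟩ := (hR.and_eventually hnear).exists
  have hat₁ : a < t₁ := (le_max_left _ _).trans_lt ht₁.1
  have hbt₁ : (|M| + 1) * (b - t₁) < 1 := by
    rw [← lt_div_iff₀' hM0]
    linarith [(le_max_right _ _).trans_lt ht₁.1]
  have hαc : ContinuousOn α (Ico a b) := fun t ht => (hα t ht).continuousWithinAt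
  have hsub : ∀ t < b, Icc t₁ t ⊆ Ico a b := fun t ht s hs =>
    ⟨hat₁.le.trans hs.1, hs.2.trans_lt ht⟩
  have hge : ∀ s ∈ Ico a b, Ico a b ∈ 𝓝[≥] s := fun s hs =>
    mem_of_superset (Ico_mem_nhdsGE hs.2) (Ico_subset_Ico_left hs.1)
  have hbound : ∀ t ∈ Ico t₁ b, ‖α t - α t₁‖ ≤ (|M| + 1) * (t - t₁) := by
    intro t ht
    refine image_norm_le_of_norm_deriv_right_lt_deriv_boundary (a := t₁) (b := t)
      (f := fun s => α s - α t₁) (f' := fun s => g s (α s)) (B := fun s => (|M| + 1) * (s - t₁))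
      (B' := fun _ => |M| + 1) ((hαc.mono (hsub t ht.2)).sub continuousOn_const)
      (fun s hs => ?_) (by simp) (fun s => ?_) (fun s hs heq => ?_) ⟨ht.1, le_rfl⟩
    · have hs' := hsub t ht.2 (Ico_subset_Icc_self hs)
      exact ((hα s hs').mono_of_mem_nhdsWithin (hge s hs')).sub_const _
    · simpa using ((hasDerivAt_id s).sub_const t₁).const_mul (|M| + 1)
    · have h1 : ‖α s - α t₁‖ ≤ 1 := by
        rw [heq]
        refine le_trans ?_ hbt₁.le
        have : s < b := hs.2.trans ht.2
        gcongr
      have h2 : ‖α s‖ ≤ R + 1 := by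
        have := norm_le_norm_add_norm_sub' (α s) (α t₁)
        linarith
      have h3 := hM s (Ico_subset_Icc_self (hsub t ht.2 (Ico_subset_Icc_self hs))) _ h2
      exact h3.trans_lt ((le_abs_self M).trans_lt (lt_add_one _))
  have hgM : ∀ t ∈ Ico t₁ b, ‖g t (α t)‖ ≤ |M| + 1 := by
    intro t ht
    have h1 := hbound t ht
    have h2 : (|M| + 1) * (t - t₁) ≤ (|M| + 1) * (b - t₁) := by
      have := ht.2
      gcongr
    have := norm_le_norm_add_norm_sub' (α t) (α t₁)
    have h3 := hM t ⟨hat₁.le.trans ht.1, ht.2.le⟩ (α t) (by linarith)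
    exact h3.trans ((le_abs_self M).trans (by linarith))
  have hlip : ∀ s ∈ Ico t₁ b, ∀ t ∈ Ico t₁ b, ‖α t - α s‖ ≤ (|M| + 1) * ‖t - s‖ := by
    intro s hs t ht
    exact (convex_Ico t₁ b).norm_image_sub_le_of_norm_hasDerivWithin_le
      (f' := fun s => g s (α s))
      (fun u hu => (hα u ⟨hat₁.le.trans hu.1, hu.2⟩).mono (Ico_subset_Ico_left hat₁.le))
      hgM hs ht
  obtain ⟨l, hlim⟩ : ∃ l, Tendsto α (𝓝[<] b) (𝓝 l) := by
    refine CompleteSpace.complete (Metric.cauchy_iff.2 ⟨inferInstance, fun ε hε => ?_⟩)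
    let d := ε / (|M| + 1)
    have hd : 0 < d := by positivity
    refine ⟨α '' Ioo (max t₁ (b - d)) b,
      image_mem_map (Ioo_mem_nhdsLT (max_lt ht₁.2 (by linarith))), ?_⟩
    rintro _ ⟨s, hs, rfl⟩ _ ⟨t, ht, rfl⟩
    have hs1 := max_lt_iff.1 hs.1
    have ht1 := max_lt_iff.1 ht.1
    rw [dist_eq_norm]
    refine (hlip t ⟨ht1.1.le, ht.2⟩ s ⟨hs1.1.le, hs.2⟩).trans_lt ?_
    rw [← lt_div_iff₀' hM0, Real.norm_eq_abs, abs_lt]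
    constructor <;> linarith [hs.2, ht.2, hs1.2, ht1.2]
  let γ : ℝ → E := Function.update α b l
  have hγ : ∀ t, t ≠ b → γ t = α t := fun t ht => Function.update_of_ne ht _ _
  have hγb : γ b = l := Function.update_self _ _ _
  have hγd : ∀ t ∈ Ioo a b, HasDerivAt γ (g t (α t)) t := fun t ht =>
    ((hα t (Ioo_subset_Ico_self ht)).hasDerivAt (Ico_mem_nhds ht.1 ht.2)).congr_of_eventuallyEq <|
      (eventually_ne_nhds ht.2.ne).mono fun s hs => hγ s hs
  refine ⟨γ, hγ a hab.ne, fun t ht => ?_⟩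
  rcases ht.2.lt_or_eq with htb | rfl
  · rw [hγ t htb.ne]
    have h1 : HasDerivWithinAt α (g t (α t)) (Icc a b) t :=
      (hα t ⟨ht.1, htb⟩).mono_of_mem_nhdsWithin <|
        mem_of_superset (inter_mem_nhdsWithin _ (Iio_mem_nhds htb)) fun s hs => ⟨hs.1.1, hs.2⟩
    exact h1.congr_of_eventuallyEq
      (mem_nhdsWithin_of_mem_nhds ((eventually_ne_nhds htb.ne).mono fun s hs => hγ s hs))
      (hγ t htb.ne)
  · rw [hγb]
    have hlim' : Tendsto γ (𝓝[<] t) (𝓝 l) := hlim.congr' <|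
      eventually_nhdsWithin_of_forall fun s (hs : s < t) => (hγ s hs.ne).symm
    refine (hasDerivWithinAt_Iic_of_tendsto_deriv (s := Ioo a t)
      (fun s hs => (hγd s hs).differentiableAt.differentiableWithinAt) ?_
      (Ioo_mem_nhdsLT hab) ?_).mono Icc_subset_Iic_self
    · rw [ContinuousWithinAt, hγb]
      exact hlim'.mono_left (nhdsWithin_mono _ Ioo_subset_Iio_self)
    · have h1 : Tendsto (fun s => g s (α s)) (𝓝[<] t) (𝓝 (g t l)) :=
        (hc.tendsto (t, l)).comp ((tendsto_id.mono_left nhdsWithin_le_nhds).prodMk_nhds hlim)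
      refine h1.congr' ?_
      filter_upwards [Ioo_mem_nhdsLT hab] with s hs
      exact (hγd s hs).deriv.symm

/-- Solutions on the intervals `[a, s]` with `s ∈ J` fit together to a solution on `J`. -/
theorem IsLocallyLipschitzField.exists_glue {g : ℝ → E → E} (hl : IsLocallyLipschitzField g)
    {J : Set ℝ} {a : ℝ} (ha : IsLeast J a) {x₀ : E}
    (h : ∀ t ∈ J, ∃ s, t < s ∧ ∃ α : ℝ → E, α a = x₀ ∧ IsIntegralCurveOn α g (Icc a s)) :
    ∃ α : ℝ → E, α a = x₀ ∧ IsIntegralCurveOn α g J := by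
  have h' : ∀ t, ∃ s, ∃ α : ℝ → E, t ∈ J → t < s ∧ α a = x₀ ∧ IsIntegralCurveOn α g (Icc a s) := by
    intro t
    by_cases ht : t ∈ J
    · obtain ⟨s, hs, α, hα⟩ := h t ht
      exact ⟨s, α, fun _ => ⟨hs, hα⟩⟩
    · exact ⟨0, fun _ => 0, fun h => (ht h).elim⟩
  choose s α hα using h'
  have key : ∀ t ∈ J, ∀ u ∈ J, u < s t → α u u = α t u := by
    intro t ht u hu hut
    obtain ⟨hs, h0, hi⟩ := hα u hu
    obtain ⟨hs', h0', hi'⟩ := hα t ht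
    exact hl.eqOn_Icc (hi.mono (Icc_subset_Icc_right hs.le))
      (hi'.mono (Icc_subset_Icc_right hut.le))
      (h0.trans h0'.symm) ⟨ha.2 hu, le_rfl⟩
  refine ⟨fun t => α t t, (hα a ha.1).2.1, fun t ht => ?_⟩
  obtain ⟨hs, -, hi⟩ := hα t ht
  have hmem : J ∩ Iio (s t) ∈ 𝓝[J] t := inter_mem_nhdsWithin _ (Iio_mem_nhds hs)
  refine ((hi t ⟨ha.2 ht, hs.le⟩).mono_of_mem_nhdsWithin
    (mem_of_superset hmem fun u hu => ⟨ha.2 hu.1, hu.2.le⟩)).congr_of_eventuallyEq ?_ rfl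
  filter_upwards [hmem] with u hu
  exact key t ht u hu.1 hu.2

/-- The solution through `(t₀, x₀)` of an equation whose right-hand side is bounded on bounded sets
exists for all later times or blows up in norm at a finite time. -/
theorem IsLocallyLipschitzField.exists_global_or_blowUp [CompleteSpace E] {g : ℝ → E → E}
    (hl : IsLocallyLipschitzField g) (hc : Continuous fun p : ℝ × E => g p.1 p.2) (t₀ : ℝ) (x₀ : E)
    (hbd : ∀ T R : ℝ, ∃ M : ℝ, ∀ t ∈ Icc t₀ T, ∀ x : E, ‖x‖ ≤ R → ‖g t x‖ ≤ M) :
    (∃ α : ℝ → E, α t₀ = x₀ ∧ IsIntegralCurveOn α g (Ici t₀)) ∨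
      ∃ b > t₀, ∃ α : ℝ → E, α t₀ = x₀ ∧ IsIntegralCurveOn α g (Ico t₀ b) ∧
        Tendsto (fun t => ‖α t‖) (𝓝[<] b) atTop := by
  let T : Set ℝ := {s | ∃ α : ℝ → E, α t₀ = x₀ ∧ IsIntegralCurveOn α g (Icc t₀ s)}
  by_cases hT : BddAbove T
  · obtain ⟨ε, hε, α₀, hα₀⟩ := hl.exists_local hc t₀ x₀
    have hlt : t₀ < sSup T := lt_of_lt_of_le (by linarith) (le_csSup hT ⟨α₀, hα₀⟩)
    have hne : T.Nonempty := ⟨_, α₀, hα₀⟩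
    refine Or.inr ⟨sSup T, hlt, ?_⟩
    have hnot : sSup T ∉ T := by
      rintro ⟨α, h0, hα⟩
      obtain ⟨ε, hε, β, hβ0, hβ⟩ := hl.exists_local hc (sSup T) (α (sSup T))
      obtain ⟨γ, hγ0, hγ⟩ :=
        exists_isIntegralCurveOn_Icc_glue hlt.le (by linarith) hα hβ hβ0.symm
      have := le_csSup hT (show sSup T + ε ∈ T from ⟨γ, hγ0.trans h0, hγ⟩)
      linarith
    obtain ⟨α, h0, hα⟩ := hl.exists_glue (J := Ico t₀ (sSup T)) (isLeast_Ico hlt)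
      (x₀ := x₀) fun t ht => by
        obtain ⟨s, hs, hts⟩ := exists_lt_of_lt_csSup hne ht.2
        exact ⟨s, hts, hs⟩
    refine ⟨α, h0, hα, ?_⟩
    by_contra hnt
    obtain ⟨γ, hγ0, hγ⟩ := exists_isIntegralCurveOn_Icc_of_not_tendsto hc hlt (hbd _) hα hnt
    exact hnot ⟨γ, hγ0.trans h0, hγ⟩
  · refine Or.inl (hl.exists_glue isLeast_Ici fun t _ => ?_)
    rw [not_bddAbove_iff] at hT
    obtain ⟨s, hs, hts⟩ := hT t
    exact ⟨s, hts, hs⟩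

/-- A solution that blows up in norm at `b` cannot be continued to `b`. -/
theorem IsLocallyLipschitzField.subset_Ico_of_blowUp {g : ℝ → E → E}
    (hl : IsLocallyLipschitzField g) {a b : ℝ} (hab : a < b) {α : ℝ → E}
    (hα : IsIntegralCurveOn α g (Ico a b)) (hb : Tendsto (fun t => ‖α t‖) (𝓝[<] b) atTop)
    {J : Set ℝ} (hJ : J.OrdConnected) (ha : IsLeast J a) {β : ℝ → E}
    (hβ : IsIntegralCurveOn β g J) (h : β a = α a) : J ⊆ Ico a b := by
  intro t ht
  refine ⟨ha.2 ht, not_le.1 fun hbt => ?_⟩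
  have hsub : Icc a b ⊆ J := (Icc_subset_Icc_right hbt).trans (hJ.out ha.1 ht)
  have heq : EqOn β α (Ico a b) := hl.eqOn ordConnected_Ico (isLeast_Ico hab)
    (hβ.mono (Ico_subset_Icc_self.trans hsub)) hα h
  have h1 : Tendsto β (𝓝[<] b) (𝓝 (β b)) :=
    ((hβ b (hsub ⟨hab.le, le_rfl⟩)).continuousWithinAt.mono hsub).mono_of_mem_nhdsWithin
      (mem_of_superset (Ioo_mem_nhdsLT hab) Ioo_subset_Icc_self)
  refine not_tendsto_nhds_of_tendsto_atTop hb _ (h1.norm.congr' ?_)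
  filter_upwards [Ioo_mem_nhdsLT hab] with s hs
  rw [heq (Ioo_subset_Ico_self hs)]

end ODE

end DegenerateEq
namespace DegenerateEq

/-! ### Growth of a minimum of functions along a solution -/

section Growth

variable {ι : Type*} [Fintype ι] [Nonempty ι]

/-- A minimum of finitely many `C¹` functions grows at least as fast as `ψ` if, at each time, some
function at which the minimum is attained does.  The minimum is Lipschitz, and wherever it is
differentiable its derivative is that of every function attaining it. -/
theorem integral_le_iInf_sub_iInf {h h' : ι → ℝ → ℝ} {a b : ℝ} (hab : a ≤ b)
    (hh : ∀ i, ∀ t ∈ Icc a b, HasDerivWithinAt (h i) (h' i t) (Icc a b) t)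
    (hh' : ∀ i, ContinuousOn (h' i) (Icc a b)) {ψ : ℝ → ℝ} (hψ : IntegrableOn ψ (Icc a b))
    (hact : ∀ t ∈ Icc a b, ∃ i, (∀ k, h i t ≤ h k t) ∧ ψ t ≤ h' i t) :
    ∫ t in a..b, ψ t ≤ (⨅ i, h i b) - ⨅ i, h i a := by
  have hbdd : ∀ t, BddBelow (range fun i => h i t) := fun t => (finite_range _).bddBelow
  set u : ℝ → ℝ := fun t => ⨅ i, h i t with hu
  have hule : ∀ t i, u t ≤ h i t := fun t i => ciInf_le (hbdd t) i
  have hueq : ∀ t i, (∀ k, h i t ≤ h k t) → u t = h i t := fun t i hi =>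
    le_antisymm (hule t i) (le_ciInf hi)
  choose c hc using fun i => (isCompact_Icc.exists_bound_of_continuousOn (hh' i))
  have hCnn : 0 ≤ ∑ i, |c i| := Finset.sum_nonneg fun i _ => abs_nonneg _
  have hC : ∀ i, ∀ t ∈ Icc a b, ‖h' i t‖ ≤ ∑ i, |c i| := fun i t ht =>
    (hc i t ht).trans <| (le_abs_self _).trans <|
      Finset.single_le_sum (f := fun i => |c i|) (fun i _ => abs_nonneg _) (Finset.mem_univ i)
  obtain ⟨C, hCe⟩ : ∃ C : NNReal, (C : ℝ) = ∑ i, |c i| := ⟨⟨_, hCnn⟩, rfl⟩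
  have hlip : LipschitzOnWith C u (Icc a b) := by
    refine LipschitzOnWith.of_le_add_mul C fun s hs t ht => ?_
    obtain ⟨i, hi, -⟩ := hact t ht
    have h1 := (convex_Icc a b).norm_image_sub_le_of_norm_hasDerivWithin_le (hh i) (hC i) ht hs
    have h2 := (le_abs_self _).trans h1
    rw [hueq t i hi, dist_eq_norm, hCe]
    linarith [hule s i]
  have hac : AbsolutelyContinuousOnInterval u a b := by
    rw [← uIcc_of_le hab] at hlip
    exact hlip.absolutelyContinuousOnInterval
  rw [show (⨅ i, h i b) - ⨅ i, h i a = u b - u a from rfl, ← hac.integral_deriv_eq_sub]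
  refine intervalIntegral.integral_mono_ae_restrict hab
    ((intervalIntegrable_iff_integrableOn_Icc_of_le hab).2 hψ) hac.intervalIntegrable_deriv ?_
  have hend : ∀ᵐ t : ℝ, t ≠ a ∧ t ≠ b := by
    have h1 : ∀ x : ℝ, ∀ᵐ t : ℝ, t ≠ x := fun x => by simp [ae_iff]
    exact (h1 a).and (h1 b)
  rw [EventuallyLE, ae_restrict_iff' measurableSet_Icc]
  filter_upwards [hac.ae_differentiableAt, hend] with t hd hne ht
  rw [uIcc_of_le hab] at hd
  obtain ⟨i, hi, hψi⟩ := hact t ht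
  have hnhds : Icc a b ∈ 𝓝 t :=
    Icc_mem_nhds (lt_of_le_of_ne ht.1 hne.1.symm) (lt_of_le_of_ne ht.2 hne.2)
  have hmin : IsLocalMin (fun s => h i s - u s) t := Eventually.of_forall fun s => by
    change h i t - u t ≤ h i s - u s
    rw [hueq t i hi, sub_self]
    linarith [hule s i]
  have h0 := hmin.hasDerivAt_eq_zero (((hh i t ht).hasDerivAt hnhds).sub (hd ht).hasDerivAt)
  linarith

/-- A minimum `v` of positive `C¹` functions that satisfies `v' ≥ U(v) ψ` cannot exist for all
times if `∫^∞ du / U(u) < ∞` and `∫^∞ ψ = ∞`: the function `∫_1^v du / U(u)` is bounded and grows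
at least as fast as `ψ`. -/
theorem false_of_forall_growth {v v' : ι → ℝ → ℝ} {a : ℝ}
    (hv : ∀ i, ∀ t ∈ Ici a, HasDerivWithinAt (v i) (v' i t) (Ici a) t)
    (hv' : ∀ i, ContinuousOn (v' i) (Ici a)) (hpos : ∀ i, ∀ t ∈ Ici a, 0 < v i t)
    {U : ℝ → ℝ} (hUcont : ContinuousOn U (Ioi 0)) (hUpos : ∀ u, 0 < u → 0 < U u)
    (hUint : IntegrableOn (fun u => 1 / U u) (Ioi 1))
    {ψ : ℝ → ℝ} (hψ : ∀ T, IntegrableOn ψ (Icc a T))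
    (hψdiv : Tendsto (fun T => ∫ t in a..T, ψ t) atTop atTop)
    (hact : ∀ t ∈ Ici a, ∃ i, (∀ k, v i t ≤ v k t) ∧ U (v i t) * ψ t ≤ v' i t) : False := by
  have hcont : ContinuousOn (fun u => 1 / U u) (Ioi 0) :=
    continuousOn_const.div hUcont fun u hu => (hUpos u hu).ne'
  have hII : ∀ x y : ℝ, 0 < x → 0 < y → IntervalIntegrable (fun u => 1 / U u) volume x y :=
    fun x y hx hy => (hcont.mono fun u hu => (lt_min hx hy).trans_le hu.1).intervalIntegrable
  have hnn : ∀ u, 0 < u → 0 ≤ 1 / U u := fun u hu => (one_div_pos.2 (hUpos u hu)).le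
  let F : ℝ → ℝ := fun y => ∫ u in (1 : ℝ)..y, 1 / U u
  have hFd : ∀ y, 0 < y → HasDerivAt F (1 / U y) y := fun y hy =>
    intervalIntegral.integral_hasDerivAt_right (hII 1 y one_pos hy)
      (hcont.stronglyMeasurableAtFilter isOpen_Ioi y hy) (hcont.continuousAt (Ioi_mem_nhds hy))
  have hFmono : ∀ x y, 0 < x → x ≤ y → F x ≤ F y := by
    intro x y hx hxy
    have h1 := intervalIntegral.integral_add_adjacent_intervals (hII 1 x one_pos hx)
      (hII x y hx (hx.trans_le hxy))
    have h2 : 0 ≤ ∫ u in x..y, 1 / U u :=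
      intervalIntegral.integral_nonneg hxy fun u hu => hnn u (hx.trans_le hu.1)
    change (∫ u in (1 : ℝ)..x, 1 / U u) ≤ ∫ u in (1 : ℝ)..y, 1 / U u
    linarith
  have hFle : ∀ y, 0 < y → F y ≤ ∫ u in Ioi 1, 1 / U u := by
    intro y hy
    refine (hFmono y (max 1 y) hy (le_max_right _ _)).trans ?_
    change (∫ u in (1 : ℝ)..max 1 y, 1 / U u) ≤ _
    rw [intervalIntegral.integral_of_le (le_max_left _ _)]
    refine setIntegral_mono_set hUint ?_ Ioc_subset_Ioi_self.eventuallyLE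
    filter_upwards [ae_restrict_mem measurableSet_Ioi] with u hu
    exact hnn u (one_pos.trans hu)
  have hbound : ∀ T, a ≤ T →
      ∫ t in a..T, ψ t ≤ (∫ u in Ioi 1, 1 / U u) - ⨅ i, F (v i a) := by
    intro T hT
    have hsub : Icc a T ⊆ Ici a := Icc_subset_Ici_self
    have h1 := integral_le_iInf_sub_iInf (h := fun i t => F (v i t))
      (h' := fun i t => 1 / U (v i t) * v' i t) hT
      (fun i t ht => (hFd _ (hpos i t (hsub ht))).comp_hasDerivWithinAt t
        ((hv i t (hsub ht)).mono hsub))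
      (fun i => ((hcont.comp (fun t ht => (hv i t ht).continuousWithinAt)
        fun t ht => hpos i t ht).mul (hv' i)).mono hsub) (hψ T) fun t ht => by
        obtain ⟨i, hi, hiψ⟩ := hact t (hsub ht)
        have hp := hpos i t (hsub ht)
        refine ⟨i, fun k => hFmono _ _ hp (hi k), ?_⟩
        rw [one_div, le_inv_mul_iff₀ (hUpos _ hp)]
        exact hiψ
    refine h1.trans (sub_le_sub_right ?_ _)
    let i := Classical.arbitrary ι
    exact (ciInf_le (finite_range _).bddBelow i).trans (hFle _ (hpos i T hT))
  obtain ⟨T, hT1, hT2⟩ := ((hψdiv.eventually_gt_atTop _).and (eventually_ge_atTop a)).exists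
  exact (hbound T hT2).not_gt hT1

end Growth

end DegenerateEq
namespace DegenerateEq

/-! ### Fixed points of a family of local contractions -/

section FixedPoint

variable {P Z : Type*} [TopologicalSpace P] [NormedAddCommGroup Z] [CompleteSpace Z]

/-- The unique fixed point `η p` of `N p` is continuous at `p₀` if the maps `N p` contract a common
ball about `η p₀`: the fixed point of `N p` in a small closed ball about `η p₀` is `η p`. -/
theorem continuousAt_fixedPoint {N : P → Z → Z} {η : P → Z} {p₀ : P} {κ : NNReal} {r : ℝ}
    (huniq : ∀ p z, N p z = z → z = η p)
    (hN : Tendsto (fun p => N p (η p₀)) (𝓝 p₀) (𝓝 (η p₀))) (hκ : κ < 1) (hr : 0 < r)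
    (hcontr : ∀ᶠ p in 𝓝 p₀, ∀ y ∈ Metric.ball (η p₀) r, ∀ z ∈ Metric.ball (η p₀) r,
      ‖N p y - N p z‖ ≤ κ * ‖y - z‖) :
    ContinuousAt η p₀ := by
  rw [Metric.continuousAt_iff']
  intro ε hε
  set ρ : ℝ := min ε r / 2 with hρ
  have hρ0 : 0 < ρ := by positivity
  have hρε : ρ < ε := by linarith [min_le_left ε r]
  have hρr : ρ < r := by linarith [min_le_right ε r]
  have hκ' : (0 : ℝ) < 1 - κ := sub_pos.2 (by exact_mod_cast hκ)
  filter_upwards [hcontr, Metric.tendsto_nhds.1 hN ((1 - κ) * ρ) (mul_pos hκ' hρ0)] with p h1 h2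
  rw [dist_eq_norm] at h2
  have hsub : Metric.closedBall (η p₀) ρ ⊆ Metric.ball (η p₀) r :=
    Metric.closedBall_subset_ball hρr
  have hmaps : MapsTo (N p) (Metric.closedBall (η p₀) ρ) (Metric.closedBall (η p₀) ρ) := by
    intro z hz
    have h3 := h1 z (hsub hz) (η p₀) (Metric.mem_ball_self hr)
    have h4 : ‖z - η p₀‖ ≤ ρ := by rwa [← dist_eq_norm]
    rw [Metric.mem_closedBall, dist_eq_norm]
    calc ‖N p z - η p₀‖ ≤ ‖N p z - N p (η p₀)‖ + ‖N p (η p₀) - η p₀‖ :=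
          norm_sub_le_norm_sub_add_norm_sub _ _ _
      _ ≤ κ * ρ + (1 - κ) * ρ := by
          refine add_le_add (h3.trans ?_) h2.le
          gcongr
      _ = ρ := by ring
  have hK : ContractingWith κ (hmaps.restrict (N p) _ _) :=
    ⟨hκ, LipschitzWith.of_dist_le_mul fun y z => by
      rw [Subtype.dist_eq, Subtype.dist_eq, dist_eq_norm, dist_eq_norm]
      exact h1 y (hsub y.2) z (hsub z.2)⟩
  obtain ⟨y, hy, hyfix, -⟩ := ContractingWith.exists_fixedPoint'
    Metric.isClosed_closedBall.isComplete hmaps hK (Metric.mem_closedBall_self hρ0.le) (edist_ne_top _ _)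
  rw [← huniq p y hyfix]
  exact (Metric.mem_closedBall.1 hy).trans_lt hρε

end FixedPoint

namespace CanonicalSystem

variable {𝕜 X Y : Type*} [RCLike 𝕜]
  [NormedAddCommGroup X] [NormedSpace 𝕜 X] [NormedAddCommGroup Y] [NormedSpace 𝕜 Y]
  {A B : X →ₗ.[𝕜] Y} {hAB : A.domain ≤ B.domain} {n : ℕ} (S : CanonicalSystem A B hAB n)

/-! ### The algebraic part of the equation -/

theorem F2star_eq (f : ℝ → A.domain → Y) (t : ℝ) (x z : A.domain) :
    S.F2star f t (S.P1 x) (S.P2Sigma x) z =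
      S.projY2star (f t (S.P1 x + S.P2Sigma x + z) -
        onDomain A B hAB (S.P1 x + S.P2Sigma x + z)) := by
  have h : S.projY2star (onDomain A B hAB (S.P1 x)) = 0 :=
    (S.projY2star_eq_zero_iff _).2 (S.Q2star_B_P1 x)
  have h' : S.projY2star (onDomain A B hAB (S.P1 x + S.P2Sigma x + z)) =
      S.projY2star (onDomain A B hAB (z + S.P2Sigma x)) := by
    rw [add_assoc, map_add, map_add, h, zero_add, add_comm]
  rw [F2star, map_sub, h']

theorem F2star_eq_zero_of_mem_L0 {f : ℝ → A.domain → Y} {t : ℝ} {x : A.domain}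
    (h : (t, x) ∈ S.L0 f) : S.F2star f t (S.P1 x) (S.P2Sigma x) (S.P20 x) = 0 := by
  rw [F2star_eq, P1_add_P2Sigma, sub_add_cancel, projY2star_eq_zero_iff]
  exact h.2

/-- The restriction of `B` to the finite-dimensional space `ker A`. -/
def BD20 : S.D20 →L[𝕜] Y :=
  LinearMap.toContinuousLinearMap (onDomain A B hAB ∘ₗ S.D20.subtype)

theorem BD20_apply (z : S.D20) : S.BD20 z = onDomain A B hAB (z : A.domain) := rfl

/-- The residual `Q_2* [f(t, x) - B x]` of the algebraic equation at `x = E w + z`, where `E`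
stands for `Ã⁻¹`; it is extended to negative times by its value at `t = 0`. -/
def residual (f : ℝ → A.domain → Y) (E : Y →L[𝕜] A.domain) (p : ℝ × S.W) (z : S.D20) :
    S.Y2star :=
  S.projY2star (f (max p.1 0) (E p.2 + z) - onDomain A B hAB (E p.2 + z))

/-- `f` is differentiable in `x` strictly and locally uniformly in `t`. -/
theorem exists_norm_sub_sub_le {f : ℝ → A.domain → Y} {f' : ℝ → A.domain → (A.domain →L[𝕜] Y)}
    (hd : ∀ t : ℝ, 0 ≤ t → ∀ x, HasFDerivAt (f t) (f' t x) x)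
    (hc : ContinuousOn (fun p : ℝ × A.domain => f' p.1 p.2) (Ici 0 ×ˢ univ))
    {t' : ℝ} (ht' : 0 ≤ t') (x' : A.domain) {c : ℝ} (hc0 : 0 < c) :
    ∃ ρ > 0, ∀ t : ℝ, 0 ≤ t → |t - t'| < ρ → ∀ x ∈ Metric.ball x' ρ, ∀ y ∈ Metric.ball x' ρ,
      ‖f t x - f t y - f' t' x' (x - y)‖ ≤ c * ‖x - y‖ := by
  let : NormedSpace ℝ A.domain := NormedSpace.restrictScalars ℝ 𝕜 A.domain
  obtain ⟨ρ, hρ, h⟩ := Metric.continuousWithinAt_iff.1 (hc (t', x') ⟨ht', mem_univ _⟩) c hc0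
  refine ⟨ρ, hρ, fun t ht htt x hx y hy => ?_⟩
  refine (convex_ball x' ρ).norm_image_sub_le_of_norm_hasFDerivWithin_le' (𝕜 := 𝕜)
    (f' := fun x => f' t x) (fun z _ => (hd t ht z).hasFDerivWithinAt) (fun z hz => ?_) hy hx
  have h1 := h (x := (t, z)) ⟨ht, mem_univ _⟩ (by
    rw [Prod.dist_eq, max_lt_iff]
    exact ⟨htt, hz⟩)
  rw [dist_eq_norm] at h1
  exact h1.le

theorem locallyLipschitzInX_of_differentiableCondition {f : ℝ → A.domain → Y}
    {Wop : ℝ → A.domain → (S.D20 →L[𝕜] S.Y2star)} (h : S.DifferentiableCondition f Wop) :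
    LocallyLipschitzInX f := by
  obtain ⟨f', hd, hc, -⟩ := h
  intro t' ht' x'
  obtain ⟨ρ, hρ, h⟩ := exists_norm_sub_sub_le hd hc ht' x' one_pos
  refine ⟨ρ, hρ, 1 + ‖f' t' x'‖, by positivity, fun t ht htt x y hx hy => ?_⟩
  have h1 := h t ht htt x (mem_ball_iff_norm.2 hx) y (mem_ball_iff_norm.2 hy)
  have h2 := (f' t' x').le_opNorm (x - y)
  have h3 := norm_le_norm_sub_add (f t x - f t y) (f' t' x' (x - y))
  linarith

section Inverse

variable {E : Y →L[𝕜] A.domain} {BE : Y →L[𝕜] Y} (hE : ∀ y, S.tildeA (E y) = y)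
  (hBE : ∀ y, BE y = onDomain A B hAB (E y))

include hE in
theorem P20_inverse (w : S.W) : S.P20 (E w) = 0 :=
  S.P20_eq_zero_of_tildeA_mem_W (by rw [hE]; exact w.2)

include hE in
theorem P1_add_P2Sigma_inverse (w : S.W) : S.P1 (E w) + S.P2Sigma (E w) = E w := by
  rw [P1_add_P2Sigma, S.P20_inverse hE, sub_zero]

include hE in
theorem A_inverse (w : S.W) : A (E w) = w := by
  rw [← S.tildeA_eq_A (S.P20_inverse hE w), hE]

include hE in
theorem inverse_A (x : A.domain) : E (A x) = x - S.P20 x := by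
  apply S.tildeA_injective
  have h1 : S.P20 (x - S.P20 x) = 0 := by
    rw [map_sub, S.P20_eq_self (S.P20_mem_D20 x), sub_self]
  have h2 : A.toFun (S.P20 x) = 0 := S.P20_mem_D20 x
  rw [hE, S.tildeA_eq_A h1]
  change A x = A.toFun _
  rw [map_sub, h2, sub_zero]
  rfl

include hE in
theorem F2star_inverse (f : ℝ → A.domain → Y) (p : ℝ × S.W) (z : S.D20) :
    S.F2star f (max p.1 0) (S.P1 (E p.2)) (S.P2Sigma (E p.2)) z = S.residual f E p z := by
  rw [F2star_eq, S.P1_add_P2Sigma_inverse hE, residual]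

include hBE in
theorem continuous_P2Sigma_inverse : Continuous fun y : Y => S.P2Sigma (E y) := by
  simp only [P2Sigma_apply, ← hBE]
  fun_prop

include hE hBE in
theorem continuous_P1_inverse : Continuous fun w : S.W => S.P1 (E w) := by
  have : (fun w : S.W => S.P1 (E w)) = fun w : S.W => E w - S.P2Sigma (E w) := by
    ext1 w
    rw [eq_sub_iff_add_eq, S.P1_add_P2Sigma_inverse hE]
  rw [this]
  exact (E.continuous.comp continuous_subtype_val).sub
    ((S.continuous_P2Sigma_inverse hBE).comp continuous_subtype_val)

/-- The inequality of the second condition, in the form common to its two versions: at each point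
of `L_0` some injective bounded operator `R`, the inverse of `W_{t',x'}`, turns the residual into a
uniform contraction `z ↦ z - R (residual z)` near that point. -/
def LocallyContracting (f : ℝ → A.domain → Y) (E : Y →L[𝕜] A.domain)
    (η : ℝ × S.W → S.D20) : Prop :=
  ∀ p₀ : ℝ × S.W, ∃ R : S.Y2star →L[𝕜] S.D20, (∀ y, R y = 0 → y = 0) ∧
    ∃ κ : NNReal, κ < 1 ∧ ∃ r > 0, ∀ᶠ p in 𝓝 p₀,
      ∀ y ∈ Metric.ball (η p₀) r, ∀ z ∈ Metric.ball (η p₀) r,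
        ‖(y - R (S.residual f E p y)) - (z - R (S.residual f E p z))‖ ≤ κ * ‖y - z‖

theorem inverse_eq_zero {Wop : S.D20 →L[𝕜] S.Y2star} (h : Wop.IsInvertible) (y : S.Y2star)
    (hy : Wop.inverse y = 0) : y = 0 := by
  rw [← h.self_apply_inverse y, hy, map_zero]

theorem norm_contraction_le {Wop : S.D20 →L[𝕜] S.Y2star} (h : Wop.IsInvertible) {c κ : ℝ}
    (hc : c * ‖Wop.inverse‖ ≤ κ) (a b : S.Y2star) (y z : S.D20)
    (hab : ‖a - b - Wop (y - z)‖ ≤ c * ‖y - z‖) :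
    ‖(y - Wop.inverse a) - (z - Wop.inverse b)‖ ≤ κ * ‖y - z‖ := by
  have h1 : (y - Wop.inverse a) - (z - Wop.inverse b) = -Wop.inverse (a - b - Wop (y - z)) := by
    rw [map_sub, map_sub, h.inverse_apply_self]
    abel
  rw [h1, norm_neg]
  calc ‖Wop.inverse (a - b - Wop (y - z))‖ ≤ ‖Wop.inverse‖ * (c * ‖y - z‖) :=
        (Wop.inverse.le_opNorm _).trans (by gcongr)
    _ = c * ‖Wop.inverse‖ * ‖y - z‖ := by ring
    _ ≤ κ * ‖y - z‖ := by gcongr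

variable {f : ℝ → A.domain → Y} {Wop : ℝ → A.domain → (S.D20 →L[𝕜] S.Y2star)}
  {η : ℝ × S.W → S.D20}

include hE hBE in
theorem locallyContracting_of_lipschitzCondition (h : S.LipschitzCondition f Wop)
    (hη : ∀ p (z : S.D20), (max p.1 0, E p.2 + z) ∈ S.L0 f ↔ z = η p) :
    S.LocallyContracting f E η := by
  intro p₀
  obtain ⟨hinv, q, ℓ, hq, hℓ, r, hr, hW⟩ := h.2 _ _ ((hη p₀ (η p₀)).2 rfl)
  set T := Wop (max p₀.1 0) (E p₀.2 + η p₀)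
  obtain ⟨κ, hκℓ, hκ1⟩ := exists_between (max_lt hℓ one_pos)
  have hκ0 : 0 ≤ κ := (le_max_right _ _).trans hκℓ.le
  have hev : ∀ᶠ d : ℝ × ℝ in 𝓝[>] 0 ×ˢ 𝓝[>] 0, q d.1 d.2 * ‖T.inverse‖ < κ :=
    (hq.mul_const _).eventually (gt_mem_nhds ((le_max_left _ _).trans_lt hκℓ))
  have hsmall : ∀ᶠ δ in 𝓝[>] (0 : ℝ), 0 < δ ∧ δ < r :=
    Ioo_mem_nhdsGT hr
  obtain ⟨⟨δ, ε⟩, hqκ, ⟨hδ, hδr⟩, hε, hεr⟩ :=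
    (hev.and (hsmall.prod_mk hsmall)).exists
  refine ⟨T.inverse, S.inverse_eq_zero hinv, ⟨κ, hκ0⟩, hκ1, ε, hε, ?_⟩
  have h20 : S.P20 (E p₀.2 + η p₀) = η p₀ := by
    rw [map_add, S.P20_inverse hE, zero_add, S.P20_eq_self (η p₀).2]
  have hP1 : S.P1 (E p₀.2 + η p₀) = S.P1 (E p₀.2) := by
    rw [map_add, S.P1_eq_zero (η p₀).2, add_zero]
  have hP2 : S.P2Sigma (E p₀.2 + η p₀) = S.P2Sigma (E p₀.2) := by
    rw [map_add, S.P2Sigma_eq_zero (η p₀).2, add_zero]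
  have e1 : ∀ᶠ p : ℝ × S.W in 𝓝 p₀, |p.1 - p₀.1| < δ :=
    (Metric.tendsto_nhds.1 (continuous_fst.tendsto p₀)) δ hδ
  have e2 : ∀ᶠ p : ℝ × S.W in 𝓝 p₀, ‖S.P1 (E p.2) - S.P1 (E p₀.2)‖ < δ := by
    have := Metric.tendsto_nhds.1
      (((S.continuous_P1_inverse hE hBE).comp continuous_snd).tendsto p₀) δ hδ
    simpa only [dist_eq_norm, Function.comp_apply] using this
  have e3 : ∀ᶠ p : ℝ × S.W in 𝓝 p₀, ‖S.P2Sigma (E p.2) - S.P2Sigma (E p₀.2)‖ < δ := by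
    have := Metric.tendsto_nhds.1 (((S.continuous_P2Sigma_inverse hBE).comp
      (continuous_subtype_val.comp continuous_snd)).tendsto p₀) δ hδ
    simpa only [dist_eq_norm, Function.comp_apply] using this
  filter_upwards [e1, e2, e3] with p h1 h2 h3 y hy z hz
  refine S.norm_contraction_le hinv (κ := κ) hqκ.le _ _ y z ?_
  rw [← S.F2star_inverse hE, ← S.F2star_inverse hE]
  refine hW δ ε hδ hδr hε hεr _ (le_max_right _ _) ((abs_max_sub_max_le_abs _ _ _).trans_lt h1)
    _ ⟨E p.2, rfl⟩ (by rwa [hP1]) _ ⟨E p.2, rfl⟩ (by rwa [hP2]) y z ?_ ?_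
  · rw [h20]; exact mem_ball_iff_norm.1 hy
  · rw [h20]; exact mem_ball_iff_norm.1 hz

theorem locallyContracting_of_differentiableCondition (h : S.DifferentiableCondition f Wop)
    (hη : ∀ p (z : S.D20), (max p.1 0, E p.2 + z) ∈ S.L0 f ↔ z = η p) :
    S.LocallyContracting f E η := by
  obtain ⟨f', hd, hc, h⟩ := h
  intro p₀
  obtain ⟨hinv, hW⟩ := h _ _ ((hη p₀ (η p₀)).2 rfl)
  set x' := E p₀.2 + η p₀
  set T := Wop (max p₀.1 0) x'
  -- `c` is such that `‖Q_2*‖ c ‖W⁻¹‖ ≤ 1/2`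
  let c : ℝ := 1 / (2 * (‖S.projY2star‖ * ‖T.inverse‖ + 1))
  have hc0 : 0 < c := by positivity
  obtain ⟨ρ, hρ, hf⟩ := exists_norm_sub_sub_le hd hc (le_max_right p₀.1 0) x' hc0
  refine ⟨T.inverse, S.inverse_eq_zero hinv, 1 / 2, by
    rw [← NNReal.coe_lt_coe]; norm_num, ρ / 2, by positivity, ?_⟩
  have e1 : ∀ᶠ p : ℝ × S.W in 𝓝 p₀, |p.1 - p₀.1| < ρ :=
    (Metric.tendsto_nhds.1 (continuous_fst.tendsto p₀)) ρ hρ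
  have e2 : ∀ᶠ p : ℝ × S.W in 𝓝 p₀, ‖E p.2 - E p₀.2‖ < ρ / 2 := by
    have := Metric.tendsto_nhds.1 ((E.continuous.comp
      (continuous_subtype_val.comp continuous_snd)).tendsto p₀) (ρ / 2) (by positivity)
    simpa only [dist_eq_norm, Function.comp_apply] using this
  filter_upwards [e1, e2] with p h1 h2 y hy z hz
  have hmem : ∀ z ∈ Metric.ball (η p₀) (ρ / 2), E p.2 + (z : A.domain) ∈ Metric.ball x' ρ := by
    intro z hz
    have hz' : ‖(z : A.domain) - η p₀‖ < ρ / 2 := mem_ball_iff_norm.1 hz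
    rw [mem_ball_iff_norm, add_sub_add_comm]
    exact (norm_add_le _ _).trans_lt (by linarith)
  have hκ : ‖S.projY2star‖ * c * ‖T.inverse‖ ≤ ((1 / 2 : NNReal) : ℝ) := by
    have : ‖S.projY2star‖ * c * ‖T.inverse‖ =
        (‖S.projY2star‖ * ‖T.inverse‖) / (2 * (‖S.projY2star‖ * ‖T.inverse‖ + 1)) := by
      simp only [c]; ring
    rw [this, div_le_iff₀ (by positivity)]
    push_cast
    linarith
  refine S.norm_contraction_le hinv hκ _ _ y z ?_
  have hWyz := hW (y - z)
  have h3 := hf (max p.1 0) (le_max_right _ _) ((abs_max_sub_max_le_abs _ _ _).trans_lt h1) _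
    (hmem y hy) _ (hmem z hz)
  rw [add_sub_add_left_eq_sub] at h3
  have h4 : S.residual f E p y - S.residual f E p z - T (y - z) =
      S.projY2star (f (max p.1 0) (E p.2 + y) - f (max p.1 0) (E p.2 + z) -
        f' (max p₀.1 0) x' (y - z)) := by
    rw [hWyz]
    simp only [residual, Submodule.coe_sub, map_sub, map_add]
    abel
  rw [h4, mul_assoc]
  exact (S.projY2star.le_opNorm _).trans (by gcongr; exact h3)

end Inverse

end CanonicalSystem

end DegenerateEq
namespace DegenerateEq

namespace CanonicalSystem

variable {𝕜 X Y : Type*} [RCLike 𝕜]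
  [NormedAddCommGroup X] [NormedSpace 𝕜 X] [NormedAddCommGroup Y] [NormedSpace 𝕜 Y]
  {A B : X →ₗ.[𝕜] Y} {hAB : A.domain ≤ B.domain} {n : ℕ} (S : CanonicalSystem A B hAB n)
  {E : Y →L[𝕜] A.domain} {BE : Y →L[𝕜] Y} (hE : ∀ y, S.tildeA (E y) = y)
  (hBE : ∀ y, BE y = onDomain A B hAB (E y))
  {f : ℝ → A.domain → Y} {η : ℝ × S.W → S.D20}

/-! ### The reduced equation on `W` -/

include hE in
/-- The solution `x_20 = η (t, w)` of the algebraic equation. -/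
theorem exists_algebraicPart (h₁ : S.UniqueAlgebraicPart f) :
    ∃ η : ℝ × S.W → S.D20, ∀ p (z : S.D20), (max p.1 0, E p.2 + z) ∈ S.L0 f ↔ z = η p := by
  have h : ∀ p : ℝ × S.W, ∃ z₀ : S.D20, ∀ z : S.D20,
      (max p.1 0, E p.2 + z) ∈ S.L0 f ↔ z = z₀ := by
    intro p
    obtain ⟨z₀, ⟨hz₀, hL⟩, huniq⟩ := h₁ (max p.1 0) (le_max_right _ _) (E p.2) (by
      rw [← S.P1_add_P2Sigma_inverse hE]
      exact Submodule.add_mem_sup ⟨_, rfl⟩ ⟨_, rfl⟩)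
    refine ⟨⟨z₀, hz₀⟩, fun z => ⟨fun h => Subtype.ext (huniq z ⟨z.2, h⟩), ?_⟩⟩
    rintro rfl
    exact hL
  choose η hη using h
  exact ⟨η, hη⟩

include hE in
theorem eq_inverse_add_of_mem_L0
    (hη : ∀ p (z : S.D20), (max p.1 0, E p.2 + z) ∈ S.L0 f ↔ z = η p)
    {t : ℝ} {x : A.domain} (h : (t, x) ∈ S.L0 f) :
    x = E (A x) + η (t, ⟨A x, S.A_mem_W x⟩) := by
  have h1 : x = E (A x) + S.P20 x := by rw [S.inverse_A hE, sub_add_cancel]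
  have h2 := (hη (t, ⟨A x, S.A_mem_W x⟩) ⟨S.P20 x, S.P20_mem_D20 x⟩).1 (by
    change (max t 0, E (A x) + S.P20 x) ∈ _
    rw [max_eq_left h.1, ← h1]
    exact h)
  rw [← h2]
  exact h1

include hE in
theorem A_inverse_add (w : S.W) (z : S.D20) : A (E w + z) = w := by
  have h : A.toFun z = 0 := z.2
  change A.toFun _ = _
  rw [map_add, h, add_zero]
  exact S.A_inverse hE w

theorem residual_eq_zero_iff (p : ℝ × S.W) (z : S.D20) :
    S.residual f E p z = 0 ↔ (max p.1 0, E p.2 + z) ∈ S.L0 f := by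
  rw [residual, projY2star_eq_zero_iff]
  exact ⟨fun h => ⟨le_max_right _ _, h⟩, fun h => h.2⟩

theorem continuous_comp_max {P : Type*} [TopologicalSpace P]
    (hf : ContinuousOn (fun p : ℝ × A.domain => f p.1 p.2) (Ici 0 ×ˢ univ))
    {τ : P → ℝ} {x : P → A.domain} (hτ : Continuous τ) (hx : Continuous x) :
    Continuous fun p => f (max (τ p) 0) (x p) :=
  hf.comp_continuous ((hτ.max continuous_const).prodMk hx)
    fun p => ⟨le_max_right (τ p) 0, mem_univ _⟩

theorem continuous_inverse_snd : Continuous fun p : ℝ × S.W => E p.2 :=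
  E.continuous.comp (continuous_subtype_val.comp continuous_snd)

include hBE in
theorem continuous_algebraicPart
    (hf : ContinuousOn (fun p : ℝ × A.domain => f p.1 p.2) (Ici 0 ×ˢ univ))
    (hη : ∀ p (z : S.D20), (max p.1 0, E p.2 + z) ∈ S.L0 f ↔ z = η p)
    (hc : S.LocallyContracting f E η) : Continuous η := by
  have : CompleteSpace S.D20 := FiniteDimensional.complete 𝕜 S.D20
  rw [continuous_iff_continuousAt]
  intro p₀
  obtain ⟨R, hR, κ, hκ, r, hr, hcontr⟩ := hc p₀
  have hres : Continuous fun p => S.residual f E p (η p₀) := by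
    have h1 : Continuous fun p : ℝ × S.W => f (max p.1 0) (E p.2 + η p₀) :=
      continuous_comp_max hf continuous_fst (S.continuous_inverse_snd.add continuous_const)
    have h2 : Continuous fun p : ℝ × S.W => onDomain A B hAB (E p.2 + η p₀) := by
      simp only [map_add, ← hBE]
      exact (BE.continuous.comp (continuous_subtype_val.comp continuous_snd)).add continuous_const
    exact S.projY2star.continuous.comp (h1.sub h2)
  refine continuousAt_fixedPoint (N := fun p z => z - R (S.residual f E p z)) ?_ ?_ hκ hr hcontr
  · intro p z hz
    rw [← hη, ← residual_eq_zero_iff]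
    exact hR _ (sub_eq_self.1 hz)
  · have h0 : S.residual f E p₀ (η p₀) = 0 := (S.residual_eq_zero_iff _ _).2 ((hη _ _).2 rfl)
    have h1 : Continuous fun p => η p₀ - R (S.residual f E p (η p₀)) :=
      continuous_const.sub (R.continuous.comp hres)
    have h2 := h1.tendsto p₀
    simp only [h0, map_zero, sub_zero] at h2
    exact h2

include hBE in
/-- Near each point the functions `η` and `f (t, Ã⁻¹ w + η (t, w))` are Lipschitz in `w`. -/
theorem exists_lipschitz_algebraicPart (hl : LocallyLipschitzInX f)
    (hη : ∀ p (z : S.D20), (max p.1 0, E p.2 + z) ∈ S.L0 f ↔ z = η p)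
    (hc : S.LocallyContracting f E η) (hηc : Continuous η) (t₀ : ℝ) (w₀ : S.W) :
    ∃ K, 0 ≤ K ∧ ∃ δ > 0, ∀ t, |t - t₀| < δ →
      ∀ v ∈ Metric.ball w₀ δ, ∀ w ∈ Metric.ball w₀ δ,
        ‖η (t, v) - η (t, w)‖ ≤ K * ‖v - w‖ ∧
        ‖f (max t 0) (E v + η (t, v)) - f (max t 0) (E w + η (t, w))‖ ≤ K * ‖v - w‖ := by
  obtain ⟨R, hR, κ, hκ, r, hr, hcontr⟩ := hc (t₀, w₀)
  set x' : A.domain := E w₀ + η (t₀, w₀) with hx'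
  obtain ⟨ρ, hρ, L, hL, hf⟩ := hl (max t₀ 0) (le_max_right _ _) x'
  have e1 : ∀ᶠ p : ℝ × S.W in 𝓝 (t₀, w₀), η p ∈ Metric.ball (η (t₀, w₀)) (min r (ρ / 2)) :=
    hηc.continuousAt.eventually (Metric.ball_mem_nhds _ (by positivity))
  have e2 : ∀ᶠ p : ℝ × S.W in 𝓝 (t₀, w₀), E p.2 ∈ Metric.ball (E w₀) (ρ / 2) :=
    S.continuous_inverse_snd.continuousAt.eventually (Metric.ball_mem_nhds _ (by positivity))
  obtain ⟨d, hd, hev⟩ := Metric.eventually_nhds_iff.1 ((hcontr.and (e1.and e2)))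
  have hκ' : (0 : ℝ) < 1 - κ := sub_pos.2 (by exact_mod_cast hκ)
  set c : ℝ := ‖R‖ * (‖S.projY2star‖ * (L * ‖E‖ + ‖BE‖)) with hcdef
  have hc0 : 0 ≤ c := by positivity
  -- the Lipschitz constant of `η`, from `(1 - κ) ‖η v - η w‖ ≤ ‖R (residual v - residual w)‖`
  set K₁ : ℝ := c / (1 - κ) with hK₁
  have hK₁0 : 0 ≤ K₁ := div_nonneg hc0 hκ'.le
  refine ⟨K₁ + L * (‖E‖ + K₁), by positivity, min d ρ, by positivity, fun t ht v hv w hw => ?_⟩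
  have hmem : ∀ u ∈ Metric.ball w₀ (min d ρ), dist (t, u) (t₀, w₀) < d := fun u hu => by
    rw [Prod.dist_eq, max_lt_iff]
    exact ⟨ht.trans_le (min_le_left _ _), (Metric.mem_ball.1 hu).trans_le (min_le_left _ _)⟩
  obtain ⟨hcv, hηv, hEv⟩ := hev (hmem v hv)
  obtain ⟨hcw, hηw, hEw⟩ := hev (hmem w hw)
  rw [mem_ball_iff_norm] at hηv hEv hηw hEw
  have hEvw : ‖E (v : Y) - E (w : Y)‖ ≤ ‖E‖ * ‖v - w‖ := by
    rw [← map_sub]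
    exact E.le_opNorm _
  have hnear : ∀ u z : S.W, ‖E (u : Y) - E w₀‖ < ρ / 2 →
      ‖η (t, z) - η (t₀, w₀)‖ < min r (ρ / 2) → ‖(E u + η (t, z) : A.domain) - x'‖ < ρ := by
    intro u z h1 h2
    rw [hx', add_sub_add_comm]
    have h3 : ‖(η (t, z) : A.domain) - η (t₀, w₀)‖ < ρ / 2 := h2.trans_le (min_le_right _ _)
    exact (norm_add_le _ _).trans_lt (by linarith)
  have hft := hf (max t 0) (le_max_right _ _)
    ((abs_max_sub_max_le_abs _ _ _).trans_lt (ht.trans_le (min_le_right _ _)))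
  have hηvw : ‖η (t, v) - η (t, w)‖ ≤ K₁ * ‖v - w‖ := by
    have h0 : ∀ p, S.residual f E p (η p) = 0 := fun p =>
      (S.residual_eq_zero_iff _ _).2 ((hη _ _).2 rfl)
    have h1 := hcv (η (t, v)) (mem_ball_iff_norm.2 (hηv.trans_le (min_le_left _ _)))
      (η (t, w)) (mem_ball_iff_norm.2 (hηw.trans_le (min_le_left _ _)))
    rw [h0, map_zero, sub_zero, sub_sub_eq_add_sub, add_sub_right_comm] at h1
    have h2 : ‖R (S.residual f E (t, v) (η (t, w)))‖ ≤ c * ‖v - w‖ := by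
      have h3 : S.residual f E (t, v) (η (t, w)) =
          S.projY2star (f (max t 0) (E v + η (t, w)) - f (max t 0) (E w + η (t, w)) -
            BE (v - w)) := by
        rw [← sub_zero (S.residual f E (t, v) (η (t, w))), ← h0 (t, w)]
        simp only [residual, map_sub, map_add, hBE]
        abel
      have h4 := hft _ _ (hnear v w hEv hηw) (hnear w w hEw hηw)
      rw [add_sub_add_right_eq_sub] at h4
      have h5 : ‖f (max t 0) (E v + η (t, w)) - f (max t 0) (E w + η (t, w)) - BE (v - w)‖ ≤
          (L * ‖E‖ + ‖BE‖) * ‖v - w‖ := by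
        have h6 : ‖BE ((v : Y) - w)‖ ≤ ‖BE‖ * ‖v - w‖ := BE.le_opNorm _
        have h7 := norm_sub_le (f (max t 0) (E v + η (t, w)) - f (max t 0) (E w + η (t, w)))
          (BE (v - w))
        have h8 : L * ‖E (v : Y) - E (w : Y)‖ ≤ L * (‖E‖ * ‖v - w‖) := by gcongr
        linarith
      rw [h3]
      calc _ ≤ ‖R‖ * (‖S.projY2star‖ * ((L * ‖E‖ + ‖BE‖) * ‖v - w‖)) := by
            refine (R.le_opNorm _).trans ?_
            gcongr
            refine (S.projY2star.le_opNorm _).trans ?_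
            gcongr
        _ = c * ‖v - w‖ := by rw [hcdef]; ring
    have h9 := norm_sub_le (η (t, v) - η (t, w) + R (S.residual f E (t, v) (η (t, w))))
      (R (S.residual f E (t, v) (η (t, w))))
    rw [add_sub_cancel_right] at h9
    rw [hK₁, div_mul_eq_mul_div, le_div_iff₀ hκ']
    linarith
  refine ⟨hηvw.trans ?_, ?_⟩
  · gcongr
    exact le_add_of_nonneg_right (by positivity)
  · have h1 := hft _ _ (hnear v v hEv hηv) (hnear w w hEw hηw)
    have h2 : ‖(E v + η (t, v) : A.domain) - (E w + η (t, w))‖ ≤ (‖E‖ + K₁) * ‖v - w‖ := by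
      rw [add_sub_add_comm, add_mul]
      exact (norm_add_le _ _).trans (add_le_add hEvw hηvw)
    calc _ ≤ L * ((‖E‖ + K₁) * ‖v - w‖) := h1.trans (by gcongr)
      _ ≤ (K₁ + L * (‖E‖ + K₁)) * ‖v - w‖ := by
        have : 0 ≤ K₁ * ‖v - w‖ := by positivity
        linarith

/-- The right-hand side of the equation `w' = (Q_1 + Q_2Σ) [f(t, x) - B x]`, with
`x = Ã⁻¹ w + η (t, w)`, satisfied by `w = A x`.  Here `E` stands for `Ã⁻¹`, and the field is
extended to negative times by its value at `t = 0`. -/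
def reducedField (f : ℝ → A.domain → Y) (E : Y →L[𝕜] A.domain) (η : ℝ × S.W → S.D20)
    (t : ℝ) (w : S.W) : S.W :=
  S.projW (f (max t 0) (E w + η (t, w)) - onDomain A B hAB (E w + η (t, w)))

include hBE in
theorem reducedField_eq (t : ℝ) (w : S.W) :
    S.reducedField f E η t w =
      S.projW (f (max t 0) (E w + η (t, w)) - (BE w + S.BD20 (η (t, w)))) := by
  rw [reducedField, map_add, hBE, BD20_apply]

include hBE in
theorem continuous_reducedField
    (hf : ContinuousOn (fun p : ℝ × A.domain => f p.1 p.2) (Ici 0 ×ˢ univ))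
    (hηc : Continuous η) : Continuous fun p : ℝ × S.W => S.reducedField f E η p.1 p.2 := by
  simp only [S.reducedField_eq hBE]
  refine S.projW.continuous.comp ((continuous_comp_max hf continuous_fst
    (S.continuous_inverse_snd.add (continuous_subtype_val.comp hηc))).sub
    ((BE.continuous.comp (continuous_subtype_val.comp continuous_snd)).add
      (S.BD20.continuous.comp hηc)))

include hBE in
theorem isLocallyLipschitzField_reducedField (hl : LocallyLipschitzInX f)
    (hη : ∀ p (z : S.D20), (max p.1 0, E p.2 + z) ∈ S.L0 f ↔ z = η p)
    (hc : S.LocallyContracting f E η) (hηc : Continuous η) :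
    IsLocallyLipschitzField (S.reducedField f E η) := by
  intro t₀ w₀
  obtain ⟨K, hK, δ, hδ, h⟩ := S.exists_lipschitz_algebraicPart hBE hl hη hc hηc t₀ w₀
  obtain ⟨C, hC⟩ : ∃ C : NNReal, (C : ℝ) = ‖S.projW‖ * (K + ‖BE‖ + ‖S.BD20‖ * K) :=
    ⟨⟨_, by positivity⟩, rfl⟩
  refine ⟨C, δ, hδ, fun t ht => LipschitzOnWith.of_dist_le_mul fun v hv w hw => ?_⟩
  obtain ⟨h1, h2⟩ := h t ht v hv w hw
  have h3 : ‖BE ((v : Y) - w)‖ ≤ ‖BE‖ * ‖v - w‖ := BE.le_opNorm _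
  have h4 : ‖S.BD20 (η (t, v) - η (t, w))‖ ≤ ‖S.BD20‖ * (K * ‖v - w‖) :=
    (S.BD20.le_opNorm _).trans (by gcongr)
  rw [dist_eq_norm, dist_eq_norm, S.reducedField_eq hBE, S.reducedField_eq hBE, ← map_sub, hC,
    mul_assoc]
  refine (S.projW.le_opNorm _).trans ?_
  gcongr
  have h5 : f (max t 0) (E v + η (t, v)) - (BE v + S.BD20 (η (t, v))) -
      (f (max t 0) (E w + η (t, w)) - (BE w + S.BD20 (η (t, w)))) =
      f (max t 0) (E v + η (t, v)) - f (max t 0) (E w + η (t, w)) - BE (v - w) -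
        S.BD20 (η (t, v) - η (t, w)) := by
    rw [map_sub, map_sub]
    abel
  rw [h5]
  refine (norm_sub_le _ _).trans ?_
  have h6 := norm_sub_le (f (max t 0) (E v + η (t, v)) - f (max t 0) (E w + η (t, w)))
    (BE (v - w))
  linarith

include hE hBE in
/-- On `L_0` the map `F_2*` vanishes, so the third condition bounds `x_20` itself, and then the
whole reduced field. -/
theorem exists_norm_reducedField_le {Wop : ℝ → A.domain → (S.D20 →L[𝕜] S.Y2star)}
    (h₃ : S.BoundednessCondition f Wop)
    (hη : ∀ p (z : S.D20), (max p.1 0, E p.2 + z) ∈ S.L0 f ↔ z = η p) (T R : ℝ) :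
    ∃ M, ∀ t ≤ T, ∀ w : S.W, ‖w‖ ≤ R → ‖S.reducedField f E η t w‖ ≤ M := by
  obtain ⟨K, hK, h20, M, hM⟩ := h₃ (max T 0 + 1) (‖E‖ * |R| + 1) (by positivity) (by positivity)
  refine ⟨M + ‖S.projW‖ * (‖BE‖ * |R| + ‖S.BD20‖ * K), fun t ht w hw => ?_⟩
  have hw' : ‖w‖ ≤ |R| := hw.trans (le_abs_self R)
  set x : A.domain := E w + η (t, w) with hx
  have hL : (max t 0, x) ∈ S.L0 f := (hη (t, w) _).2 rfl
  have hP20 : S.P20 x = η (t, w) := by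
    rw [hx, map_add, S.P20_inverse hE, zero_add, S.P20_eq_self (η (t, w)).2]
  have hP : S.P1 x + S.P2Sigma x = E w := by
    rw [P1_add_P2Sigma, hP20, hx, add_sub_cancel_right]
  have ht' : max t 0 ≤ max T 0 + 1 := (max_le_max_right 0 ht).trans (by linarith)
  have hPle : ‖S.P1 x + S.P2Sigma x‖ ≤ ‖E‖ * |R| + 1 := by
    rw [hP]
    refine (E.le_opNorm _).trans ?_
    have : ‖E‖ * ‖(w : Y)‖ ≤ ‖E‖ * |R| := by gcongr; exact hw'
    linarith
  have hxK := h20 _ x hL ht' hPle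
  rw [S.F2star_eq_zero_of_mem_L0 hL, map_zero, ZeroMemClass.coe_zero, sub_zero] at hxK
  have hηK : ‖η (t, w)‖ ≤ K := by
    rw [hP20] at hxK
    exact hxK
  have hfM : ‖S.projW (f (max t 0) x)‖ ≤ M := hM _ x hL ht' hPle hxK
  rw [S.reducedField_eq hBE, map_sub]
  refine (norm_sub_le _ _).trans (add_le_add hfM ((S.projW.le_opNorm _).trans ?_))
  gcongr
  refine (norm_add_le _ _).trans (add_le_add ?_ ?_)
  · exact (BE.le_opNorm _).trans (by gcongr; exact hw')
  · exact (S.BD20.le_opNorm _).trans (by gcongr)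

end CanonicalSystem

end DegenerateEq
namespace DegenerateEq

/-! ### Equivalence with the reduced equation -/

/-- A closed operator defined on the whole space is bounded. -/
theorem exists_norm_le_of_domain_eq_top {𝕜 X Y : Type*} [RCLike 𝕜]
    [NormedAddCommGroup X] [NormedSpace 𝕜 X] [CompleteSpace X]
    [NormedAddCommGroup Y] [NormedSpace 𝕜 Y] [CompleteSpace Y]
    {A : X →ₗ.[𝕜] Y} (hA : A.IsClosed) (h : A.domain = ⊤) :
    ∃ C : ℝ, ∀ x : A.domain, ‖A x‖ ≤ C * ‖x‖ := by
  let T : X →ₗ[𝕜] Y :=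
    A.toFun ∘ₗ LinearMap.codRestrict A.domain LinearMap.id fun x => h ▸ Submodule.mem_top
  have hT : Continuous T := by
    refine LinearMap.continuous_of_seq_closed_graph _ fun u x y hu hy => ?_
    have h2 : (x, y) ∈ A.graph :=
      IsClosed.mem_of_tendsto hA (hu.prodMk_nhds hy) <| Eventually.of_forall fun k =>
        A.mem_graph ⟨u k, h ▸ Submodule.mem_top⟩
    exact A.mem_graph_snd_inj h2 (A.mem_graph ⟨x, h ▸ Submodule.mem_top⟩) rfl
  let T' : X →L[𝕜] Y := ⟨T, hT⟩
  exact ⟨‖T'‖, fun x => T'.le_opNorm x⟩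

theorem IsForwardInterval.uniqueDiffOn {t₀ : ℝ} {J : Set ℝ} (hJ : IsForwardInterval t₀ J) :
    UniqueDiffOn ℝ J := by
  obtain ⟨hc, -, hn⟩ := hJ
  obtain ⟨a, ha, b, hb, hab⟩ := hn.exists_lt
  exact uniqueDiffOn_convex hc.convex ⟨_, interior_mono (Ioo_subset_Icc_self.trans (hc.out ha hb))
    (by rw [interior_Ioo]; exact ⟨left_lt_add_div_two.2 hab, add_div_two_lt_right.2 hab⟩)⟩

theorem isForwardInterval_Ici (t₀ : ℝ) : IsForwardInterval t₀ (Ici t₀) :=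
  ⟨ordConnected_Ici, isLeast_Ici, t₀, self_mem_Ici, t₀ + 1, by simp, by simp⟩

theorem isForwardInterval_Ico {t₀ b : ℝ} (h : t₀ < b) : IsForwardInterval t₀ (Ico t₀ b) :=
  ⟨ordConnected_Ico, isLeast_Ico h, nontrivial_of_exists_ne ⟨le_rfl, h⟩
    ⟨_, ⟨(left_lt_add_div_two.2 h).le, add_div_two_lt_right.2 h⟩, (left_lt_add_div_two.2 h).ne'⟩⟩

namespace CanonicalSystem

variable {𝕜 X Y : Type*} [RCLike 𝕜]
  [NormedAddCommGroup X] [NormedSpace 𝕜 X] [NormedAddCommGroup Y] [NormedSpace 𝕜 Y]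
  [NormedSpace ℝ Y] [IsScalarTower ℝ 𝕜 Y]
  {A B : X →ₗ.[𝕜] Y} {hAB : A.domain ≤ B.domain} {n : ℕ} (S : CanonicalSystem A B hAB n)
  {E : Y →L[𝕜] A.domain} {BE : Y →L[𝕜] Y} (hE : ∀ y, S.tildeA (E y) = y)
  (hBE : ∀ y, BE y = onDomain A B hAB (E y))
  {f : ℝ → A.domain → Y} {η : ℝ × S.W → S.D20}

include hE in
/-- If `x` solves the equation, then it takes values on `L_0`, and `A x` solves the reduced
equation. -/
theorem isIntegralCurveOn_of_isSolutionOn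
    (hη : ∀ p (z : S.D20), (max p.1 0, E p.2 + z) ∈ S.L0 f ↔ z = η p)
    {t₀ : ℝ} (ht₀ : 0 ≤ t₀) {J : Set ℝ} (hJ : IsForwardInterval t₀ J) {x : ℝ → A.domain}
    (hx : IsSolutionOn A B hAB f J x) :
    (∀ t ∈ J, (t, x t) ∈ S.L0 f) ∧
      IsIntegralCurveOn (fun t => (⟨A (x t), S.A_mem_W _⟩ : S.W)) (S.reducedField f E η) J := by
  obtain ⟨-, v, -, hv⟩ := hx
  have hL : ∀ t ∈ J, (t, x t) ∈ S.L0 f := by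
    intro t ht
    refine ⟨ht₀.trans (hJ.2.1.2 ht), ?_⟩
    obtain ⟨h1, h2⟩ := hv t ht
    have h3 : HasDerivWithinAt (fun s => S.Q2star (A (x s))) (S.Q2star (v t)) J t :=
      (S.Q2star.restrictScalars ℝ).hasFDerivAt.comp_hasDerivWithinAt t h1
    simp only [Q2star_A] at h3
    rw [← h2, add_sub_cancel_right]
    exact (hJ.uniqueDiffOn t ht).eq_deriv _ h3 (hasDerivWithinAt_const t J 0)
  refine ⟨hL, fun t ht => ?_⟩
  obtain ⟨h1, h2⟩ := hv t ht
  have h3 : HasDerivWithinAt (fun s => S.projW (A (x s))) (S.projW (v t)) J t :=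
    (S.projW.restrictScalars ℝ).hasFDerivAt.comp_hasDerivWithinAt t h1
  have h4 : (fun t => (⟨A (x t), S.A_mem_W _⟩ : S.W)) = fun s => S.projW (A (x s)) :=
    funext fun s => (S.projW_coe ⟨A (x s), S.A_mem_W _⟩).symm
  have h5 := S.eq_inverse_add_of_mem_L0 hE hη (hL t ht)
  have h6 : S.reducedField f E η t ⟨A (x t), S.A_mem_W _⟩ = S.projW (v t) := by
    change S.projW (f (max t 0) (E (A (x t)) + _) - onDomain A B hAB (E (A (x t)) + _)) = _
    rw [← h5, max_eq_left (hL t ht).1, ← h2, add_sub_cancel_right]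
  rw [h6, h4]
  exact h3

include hBE in
/-- If `w` solves the reduced equation, then `Ã⁻¹ w + η (t, w)` solves the equation. -/
theorem isSolutionOn_of_isIntegralCurveOn
    (hE : ∀ y, S.tildeA (E y) = y)
    (hf : ContinuousOn (fun p : ℝ × A.domain => f p.1 p.2) (Ici 0 ×ˢ univ))
    (hη : ∀ p (z : S.D20), (max p.1 0, E p.2 + z) ∈ S.L0 f ↔ z = η p) (hηc : Continuous η)
    {J : Set ℝ} (hJ : J ⊆ Ici 0) {w : ℝ → S.W}
    (hw : IsIntegralCurveOn w (S.reducedField f E η) J) :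
    IsSolutionOn A B hAB f J (fun t => E (w t) + η (t, w t)) := by
  have hwc : ContinuousOn w J := fun t ht => (hw t ht).continuousWithinAt
  have hpc : ContinuousOn (fun t => (t, w t)) J := continuousOn_id.prodMk hwc
  refine ⟨?_, fun t => S.reducedField f E η t (w t), ?_, fun t ht => ⟨?_, ?_⟩⟩
  · have h1 : Continuous fun p : ℝ × S.W => ((E p.2 + η p : A.domain) : X) :=
      continuous_subtype_val.comp (S.continuous_inverse_snd.add (continuous_subtype_val.comp hηc))
    exact h1.comp_continuousOn hpc
  · exact continuous_subtype_val.comp_continuousOn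
      ((S.continuous_reducedField hBE hf hηc).comp_continuousOn hpc)
  · simp only [S.A_inverse_add hE]
    exact (S.W.subtypeL.restrictScalars ℝ).hasFDerivAt.comp_hasDerivWithinAt t (hw t ht)
  · have h1 : S.Q2star (f t (E (w t) + η (t, w t)) -
        onDomain A B hAB (E (w t) + η (t, w t))) = 0 := by
      have := ((hη (t, w t) _).2 rfl).2
      rwa [max_eq_left (show (0 : ℝ) ≤ t from hJ ht)] at this
    change (S.projW (f (max t 0) (E (w t) + η (t, w t)) -
      onDomain A B hAB (E (w t) + η (t, w t))) : Y) + _ = _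
    rw [max_eq_left (show (0 : ℝ) ≤ t from hJ ht), coe_projW, h1, sub_zero, sub_add_cancel]

end CanonicalSystem

end DegenerateEq

end

theorem mainTheorem5
    {𝕜 X Y : Type*} [RCLike 𝕜]
    [NormedAddCommGroup X] [NormedSpace 𝕜 X] [CompleteSpace X]
    [NormedAddCommGroup Y] [NormedSpace 𝕜 Y] [CompleteSpace Y]
    [NormedSpace ℝ Y] [IsScalarTower ℝ 𝕜 Y]
    -- the operators `A` and `B`, with `D = D_A ⊆ D_B`
    (A B : X →ₗ.[𝕜] Y) (hAB : A.domain ≤ B.domain)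
    (hA : A.IsClosed) (hB : B.IsClosed)
    (hAd : Dense (A.domain : Set X)) (hBd : Dense (B.domain : Set X))
    (hD : A.domain ≠ ⊥) (hran : IsClosed (Set.range fun x : A.domain => A x))
    (ν : ℕ) (hν : DegenerateEq.IsRegularPencilOfIndex A B ν)
    -- a canonical system of root vectors, `n = dim ker A`
    (n : ℕ) (S : DegenerateEq.CanonicalSystem A B hAB n)
    -- the conditions on `f`
    (f : ℝ → A.domain → Y)
    (hf : ContinuousOn (fun p : ℝ × A.domain => f p.1 p.2) (Set.Ici 0 ×ˢ Set.univ))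
    (h₁ : S.UniqueAlgebraicPart f)
    (Wop : ℝ → A.domain → (S.D20 →L[𝕜] S.Y2star))
    (h₂ : S.LipschitzCondition f Wop ∨ S.DifferentiableCondition f Wop)
    (h₃ : S.BoundednessCondition f Wop)
    -- invariance of `Ω = Ã⁻¹ Ω'`
    (Ω' : Set S.W) (hΩ' : IsOpen Ω')
    (Ω : Set A.domain) (hΩ : Ω = (fun w : S.W => S.tildeAInv w) '' Ω')
    (h₄ : ∀ (t₀ : ℝ) (x₀ : A.domain), (t₀, x₀) ∈ S.L0 f → S.P1 x₀ + S.P2Sigma x₀ ∈ Ω →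
      ∀ (J : Set ℝ) (x : ℝ → A.domain), DegenerateEq.IsMaximalSolution A B hAB f t₀ J x →
        x t₀ = x₀ → ∀ t ∈ J, S.P1 (x t) + S.P2Sigma (x t) ∈ Ω)
    -- the functionals `V = min V_i`, `U` and `ψ`
    (m : ℕ) (hm : 1 ≤ m) (V : Fin m → S.W → ℝ)
    (hVcont : ∀ i, Continuous (V i)) (hVnonneg : ∀ i w, 0 ≤ V i w)
    (hVpos : ∀ i, ∀ w ∈ Ω', 0 < V i w) (hVdiff : ∀ i, ContDiffOn ℝ 1 (V i) Ω')
    (U : ℝ → ℝ) (hUcont : ContinuousOn U (Set.Ioi 0)) (hUpos : ∀ u, 0 < u → 0 < U u)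
    (ψ : ℝ → ℝ) (hψnonneg : ∀ t, 0 ≤ t → 0 ≤ ψ t)
    (hψint : ∀ T, MeasureTheory.IntegrableOn ψ (Set.Icc 0 T))
    (hUint : ∀ u₀, 0 < u₀ → MeasureTheory.IntegrableOn (fun u => 1 / U u) (Set.Ioi u₀))
    (hψdiv : ∀ u₀, 0 < u₀ →
      Filter.Tendsto (fun T => ∫ t in u₀..T, ψ t) Filter.atTop Filter.atTop)
    (j : S.W → Fin m) (hj : ∀ w, ⨅ i, V i w = V (j w) w)
    (h₅ : ∀ (t : ℝ) (w : S.W) (x₂₀ : A.domain), w ∈ Ω' → x₂₀ ∈ S.D20 →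
      (t, S.tildeAInv w + x₂₀) ∈ S.L0 f →
        U (⨅ i, V i w) * ψ t ≤
          fderiv ℝ (V (j w)) w (S.projW (S.tildeA (S.Pi f t (S.tildeAInv w + x₂₀))))) :
    ∀ (t₀ : ℝ) (x₀ : A.domain), (t₀, x₀) ∈ S.L0 f → S.P1 x₀ + S.P2Sigma x₀ ∈ Ω →
      ∃ (tmax : ℝ) (x : ℝ → A.domain),
        t₀ < tmax ∧ x t₀ = x₀ ∧
        DegenerateEq.IsMaximalSolution A B hAB f t₀ (Set.Ico t₀ tmax) x ∧
        (∀ (J : Set ℝ) (y : ℝ → A.domain), DegenerateEq.IsForwardInterval t₀ J →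
          DegenerateEq.IsSolutionOn A B hAB f J y → y t₀ = x₀ →
            J ⊆ Set.Ico t₀ tmax ∧ Set.EqOn y x J) ∧
        Filter.Tendsto (fun t => ‖A (x t)‖) (nhdsWithin tmax (Set.Iio tmax)) Filter.atTop ∧
        ((A.domain = ⊤ ∨ ∃ C : ℝ, ∀ x : A.domain, ‖A x‖ ≤ C * ‖x‖) →
          Filter.Tendsto (fun t => ‖(x t : X)‖) (nhdsWithin tmax (Set.Iio tmax)) Filter.atTop) := by
  intro t₀ x₀ hx₀ hx₀Ω
  obtain ⟨E, BE, hE, hinv, hBE⟩ := S.exists_continuousLinearMap_inverse hA hB hran hν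
  obtain ⟨η, hη⟩ := S.exists_algebraicPart hE h₁
  have hlip : DegenerateEq.CanonicalSystem.LocallyLipschitzInX f :=
    h₂.elim (fun h => h.1) S.locallyLipschitzInX_of_differentiableCondition
  have hcontr : S.LocallyContracting f E η :=
    h₂.elim (fun h => S.locallyContracting_of_lipschitzCondition hE hBE h hη)
      fun h => S.locallyContracting_of_differentiableCondition h hη
  have hηc := S.continuous_algebraicPart hBE hf hη hcontr
  have hl := S.isLocallyLipschitzField_reducedField hBE hlip hη hcontr hηc
  have hc := S.continuous_reducedField hBE hf hηc
  have ht₀ : 0 ≤ t₀ := hx₀.1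
  set w₀ : S.W := ⟨A x₀, S.A_mem_W x₀⟩ with hw₀
  have hx₀w : x₀ = E w₀ + η (t₀, w₀) := S.eq_inverse_add_of_mem_L0 hE hη hx₀
  have hbd : ∀ T R : ℝ, ∃ M : ℝ, ∀ t ∈ Icc t₀ T, ∀ w : S.W, ‖w‖ ≤ R →
      ‖S.reducedField f E η t w‖ ≤ M := fun T R => by
    obtain ⟨M, hM⟩ := S.exists_norm_reducedField_le hE hBE h₃ hη T R
    exact ⟨M, fun t ht => hM t ht.2⟩
  have hsol : ∀ {J : Set ℝ} {w : ℝ → S.W}, J ⊆ Ici t₀ →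
      IsIntegralCurveOn w (S.reducedField f E η) J →
        DegenerateEq.IsSolutionOn A B hAB f J (fun t => E (w t) + η (t, w t)) := fun hJ hw =>
    S.isSolutionOn_of_isIntegralCurveOn hBE hE hf hη hηc (hJ.trans (Ici_subset_Ici.2 ht₀)) hw
  have hWcomplete : CompleteSpace S.W := S.isClosed_W.completeSpace_coe
  rcases hl.exists_global_or_blowUp hc t₀ w₀ hbd with ⟨α, hα0, hα⟩ | ⟨b, hb, α, hα0, hα, hαb⟩
  · -- a global solution stays in `Ω`, and `min V_i` grows too fast along it
    exfalso
    have hmax : DegenerateEq.IsMaximalSolution A B hAB f t₀ (Ici t₀)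
        (fun t => E (α t) + η (t, α t)) :=
      ⟨DegenerateEq.isForwardInterval_Ici t₀, hsol subset_rfl hα, fun J' _ hJ' hss _ _ =>
        hss.2 fun t ht => hJ'.2.1.2 ht⟩
    have hmem : ∀ t ∈ Ici t₀, α t ∈ Ω' := by
      intro t ht
      have h := h₄ t₀ x₀ hx₀ hx₀Ω _ _ hmax (by simp only [hα0]; exact hx₀w.symm) t ht
      rw [hΩ, S.P1_add_P2Sigma, ← S.inverse_A hE, S.A_inverse_add hE] at h
      obtain ⟨w', hw', heq⟩ := h
      have h2 := congrArg S.tildeA heq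
      simp only [hinv, hE] at h2
      rwa [← Subtype.ext h2]
    have hsub : Ici (t₀ + 1) ⊆ Ici t₀ := Ici_subset_Ici.2 (by linarith)
    have hVd : ∀ i, ∀ w ∈ Ω', HasFDerivAt (V i) (fderiv ℝ (V i) w) w := fun i w hw =>
      (((hVdiff i).differentiableOn one_ne_zero).differentiableAt (hΩ'.mem_nhds hw)).hasFDerivAt
    have hαc : ContinuousOn α (Ici t₀) := fun t ht => (hα t ht).continuousWithinAt
    have : Nonempty (Fin m) := ⟨⟨0, hm⟩⟩
    -- the divergence of `∫ ψ` is available from positive times only, hence the start at `t₀ + 1`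
    refine DegenerateEq.false_of_forall_growth (a := t₀ + 1) (v := fun i t => V i (α t))
      (v' := fun i t => fderiv ℝ (V i) (α t) (S.reducedField f E η t (α t)))
      (fun i t ht => (hVd i _ (hmem t (hsub ht))).comp_hasDerivWithinAt t
        ((hα t (hsub ht)).mono hsub))
      (fun i => ContinuousOn.mono ?_ hsub) (fun i t ht => hVpos i _ (hmem t (hsub ht)))
      hUcont hUpos (hUint 1 one_pos)
      (fun T => (hψint T).mono_set (Icc_subset_Icc_left (by linarith)))
      (hψdiv (t₀ + 1) (by linarith)) fun t ht => ⟨j (α t), fun k => ?_, ?_⟩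
    · exact (((hVdiff i).continuousOn_fderiv_of_isOpen hΩ' le_rfl).comp hαc hmem).clm_apply
        (hc.comp_continuousOn (continuousOn_id.prodMk hαc))
    · rw [← hj]
      exact ciInf_le (finite_range _).bddBelow k
    · have ht0 : 0 ≤ t := ht₀.trans (hsub ht)
      have hL : (t, S.tildeAInv (α t) + η (t, α t)) ∈ S.L0 f := by
        have := (hη (t, α t) _).2 rfl
        rw [hinv]
        rwa [max_eq_left ht0] at this
      have h := h₅ t (α t) (η (t, α t)) (hmem t (hsub ht)) (η (t, α t)).2 hL
      have hg : S.projW (S.tildeA (S.Pi f t (S.tildeAInv (α t) + η (t, α t)))) =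
          S.reducedField f E η t (α t) := by
        rw [DegenerateEq.CanonicalSystem.Pi, hinv, hE, hinv,
            DegenerateEq.CanonicalSystem.reducedField, max_eq_left ht0]
        exact S.projW_coe (S.projW _)
      rwa [hg, hj] at h
  · set x : ℝ → A.domain := fun t => E (α t) + η (t, α t) with hx
    have hxt₀ : x t₀ = x₀ := by
      simp only [hx, hα0]
      exact hx₀w.symm
    have hAx : ∀ t, A (x t) = α t := fun t => S.A_inverse_add hE _ _
    have huniq : ∀ (J : Set ℝ) (y : ℝ → A.domain), DegenerateEq.IsForwardInterval t₀ J →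
        DegenerateEq.IsSolutionOn A B hAB f J y → y t₀ = x₀ → J ⊆ Ico t₀ b ∧ EqOn y x J := by
      intro J y hJ hy hy0
      obtain ⟨hyL, hyc⟩ := S.isIntegralCurveOn_of_isSolutionOn hE hη ht₀ hJ hy
      have h0 : (⟨A (y t₀), S.A_mem_W _⟩ : S.W) = α t₀ := by
        rw [hα0, hw₀]
        exact Subtype.ext (congrArg (fun z : A.domain => A z) hy0)
      have hsub := hl.subset_Ico_of_blowUp hb hα hαb hJ.1 hJ.2.1 hyc h0
      refine ⟨hsub, fun t ht => ?_⟩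
      rw [S.eq_inverse_add_of_mem_L0 hE hη (hyL t ht)]
      have heq : (⟨A (y t), S.A_mem_W _⟩ : S.W) = α t :=
        hl.eqOn hJ.1 hJ.2.1 hyc (hα.mono hsub) h0 ht
      rw [heq, hx]
      congr 2
      exact congrArg Subtype.val heq
    have htend : Tendsto (fun t => ‖A (x t)‖) (𝓝[<] b) atTop := by
      simp only [hAx]
      exact hαb
    refine ⟨b, x, hb, hxt₀, ⟨DegenerateEq.isForwardInterval_Ico hb, hsol Ico_subset_Ici_self hα,
      fun J' y hJ' hss hy hxy => ?_⟩, huniq, htend, fun h => ?_⟩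
    · exact hss.2 (huniq J' y hJ' hy ((hxy ⟨le_rfl, hb⟩).symm.trans hxt₀)).1
    · obtain ⟨C, hC⟩ := h.elim (DegenerateEq.exists_norm_le_of_domain_eq_top hA) id
      have hC0 : 0 < |C| + 1 := by positivity
      refine tendsto_atTop_mono (fun t => ?_) (htend.atTop_div_const hC0)
      rw [div_le_iff₀' hC0]
      refine (hC (x t)).trans ?_
      have : C ≤ |C| + 1 := (le_abs_self C).trans (by linarith)
      exact mul_le_mul_of_nonneg_right this (norm_nonneg _)
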